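/- Let $G$ be a plane triangulation, i.e. a maximal planar graph with $n\ge 3$ vertices together with a planar embedding (the counterclockwise order of the neighbours around each vertex) and a distinguished outer face. An RT-representation $R$ of $G$ assigns to each vertex $v$ a triangle $\Delta(v)$ that is the lower-right half of an axis-parallel rectangle of positive width and height (its corners are a left, a right and a top corner; the right angle is at the right corner), such that the triangles are internally disjoint, $\Delta(u)\cap\Delta(v)\neq\emptyset$ if and only if $\{u,v\}$ is an edge (for $u\ne v$), and the contacts induce the same faces and the same outer face as in $G$. Corners of different triangles may coincide. A linear morph $\langle R,R'\rangle$ consists of two RT-representations of $G$ such that, if each corner of each triangle moves with constant speed along a straight line from its position in $R$ at time $0$ to its position in $R'$ at time $1$, the triangles form an RT-representation of $G$ at every time $t\in[0,1]$. A piecewise linear morph between $R$ and $R'$ is a finite sequence $R=R_1,\dots,R_{\ell+1}=R'$ of RT-representations of $G$ such that each $\langle R_i,R_{i+1}\rangle$ is a linear morph. A Schnyder wood of $G$ is an orientation and colouring (red, blue, green) of the inner edges such that each inner vertex has exactly one outgoing edge of each colour, the edges around each inner vertex are in counterclockwise order: outgoing red, incoming green, outgoing blue, incoming red, outgoing green,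 incoming blue; and the outer vertices have no outgoing edges and are, in counterclockwise order, a red, a blue and a green one, with incoming edges of the respective colour only. A Schnyder wood $T$ corresponds to $R$ if for every edge oriented from $u$ to $v$ in $T$ the left corner of $\Delta(u)$ lies on the vertical side of $\Delta(v)$ if the edge is blue, the right corner of $\Delta(u)$ lies on the diagonal side of $\Delta(v)$ if it is green, and the top corner of $\Delta(u)$ lies on the horizontal side of $\Delta(v)$ if it is red. A facial flip of $T$ reverses a directed triangle that bounds a face, where each of its three vertices keeps the colour of its outgoing edge on the triangle, and leaves all other edges unchanged. Theorem. Let $R$ and $R'$ be RT-representations of a plane triangulation $G$ such that there is a piecewise linear morph between $R$ and $R'$. Then there are Schnyder woods corresponding to $R$ and to $R'$, and whenever $T$ corresponds to $R$ and $T'$ corresponds to $R'$, each of $T$ and $T'$ can be obtained from the other by a finite (possibly empty) sequence of facial flips. Moreover, if $G$ has more than three vertices, then each of $R$ and $R'$ has a unique topmost vertex (a vertex $v$ maximizing the y-coordinate of the horizontal side of $\Delta(v)$), and these two vertices are the same. -/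

import Mathlib

namespace RTMorph

/-! ### Plane triangulations -/

/-- A plane triangulation on the vertex set `V`, given by its rotation system: `next u v` is the
neighbour of `u` that follows the neighbour `v` in counterclockwise order around `u` (the value is
irrelevant if `v` is not a neighbour of `u`).  The face to the left of the directed edge `(u, v)`
then has the corners `u, v, next u v`. -/
structure PlaneTriangulation (V : Type*) [Fintype V] where
  /-- the underlying simple graph -/
  graph : SimpleGraph V
  connected : graph.Connected
  /-- the counterclockwise successor around a vertex -/
  next : V → V → V
  adj_next : ∀ u v, graph.Adj u v → graph.Adj u (next u v)
  /-- all neighbours of a vertex form one cycle of the rotation -/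
  rotation_cyclic : ∀ v u w, graph.Adj v u → graph.Adj v w → ∃ k : ℕ, (next v)^[k] u = w
  /-- every face is a triangle -/
  face_triangle : ∀ u v, graph.Adj u v →
    graph.Adj v (next u v) ∧ next v (next u v) = u
  /-- The rotation system is planar.  All `F` faces are triangles, so that `3 F = 2 E`, and
  Euler's formula `n - E + F = 2` is the following equation. -/
  euler : graph.edgeSet.ncard + 6 = 3 * Fintype.card V
  /-- The distinguished outer face; it lies to the left of the directed edges
  `(outer₁, outer₂)`, `(outer₂, outer₃)` and `(outer₃, outer₁)`. -/
  outer₁ : V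
  outer₂ : V
  outer₃ : V
  outer_adj : graph.Adj outer₁ outer₂
  outer_next : next outer₁ outer₂ = outer₃

namespace PlaneTriangulation

variable {V : Type*} [Fintype V] (G : PlaneTriangulation V)

/-- `u, v, w` is a face, listed with the face on the left of the directed edges `(u, v)`,
`(v, w)`, `(w, u)`; for a bounded face this is the counterclockwise order. -/
def IsFace (u v w : V) : Prop := G.graph.Adj u v ∧ G.next u v = w

/-- `u, v, w` is the outer face, listed with the outer face on the left of the directed edges;
so this is the clockwise order around the drawing. -/
def IsOuterFace (u v w : V) : Prop :=
  (u = G.outer₁ ∧ v = G.outer₂ ∧ w = G.outer₃) ∨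
  (u = G.outer₂ ∧ v = G.outer₃ ∧ w = G.outer₁) ∨
  (u = G.outer₃ ∧ v = G.outer₁ ∧ w = G.outer₂)

/-- The three vertices of the outer face; all other vertices are inner vertices. -/
def IsOuter (v : V) : Prop := v = G.outer₁ ∨ v = G.outer₂ ∨ v = G.outer₃

/-- Edges that are not on the outer face. -/
def IsInnerEdge (u v : V) : Prop := G.graph.Adj u v ∧ ¬ (G.IsOuter u ∧ G.IsOuter v)

end PlaneTriangulation

/-! ### Schnyder woods and facial flips -/

/-- The three colours. -/
inductive Color : Type
  | red
  | blue
  | green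

/-- The cyclic order red, blue, green, red. -/
def Color.succ : Color → Color
  | .red => .blue
  | .blue => .green
  | .green => .red

/-- A Schnyder wood of a plane triangulation.  `arc k u v` says that the edge `{u, v}` is
oriented from `u` to `v` and has the colour `k`. -/
@[ext]
structure SchnyderWood {V : Type*} [Fintype V] (G : PlaneTriangulation V) where
  arc : Color → V → V → Prop
  /-- only inner edges are oriented and coloured ... -/
  arc_inner : ∀ k u v, arc k u v → G.IsInnerEdge u v
  /-- ... each of them is, ... -/
  arc_exists : ∀ u v, G.IsInnerEdge u v → (∃ k, arc k u v) ∨ (∃ k, arc k v u)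
  /-- ... in one direction only ... -/
  arc_asymm : ∀ j k u v, arc j u v → ¬ arc k v u
  /-- ... and with one colour only -/
  arc_color : ∀ j k u v, arc j u v → arc k u v → j = k
  /-- an inner vertex has one outgoing edge of each colour -/
  out_inner : ∀ v, ¬ G.IsOuter v → ∀ k, ∃! u, arc k v u
  /-- outer vertices have no outgoing edge -/
  out_outer : ∀ v, G.IsOuter v → ∀ k u, ¬ arc k v u
  /-- In counterclockwise order around an inner vertex there are: the outgoing red edge, incoming
  green edges, the outgoing blue edge, incoming red edges, the outgoing green edge, incoming blue
  edges.  Here: what may follow an outgoing edge. -/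
  after_out : ∀ v, ¬ G.IsOuter v → ∀ k u, arc k v u →
    arc k.succ.succ (G.next v u) v ∨ arc k.succ v (G.next v u)
  /-- The same: what may follow an incoming edge. -/
  after_in : ∀ v, ¬ G.IsOuter v → ∀ k u, arc k u v →
    arc k (G.next v u) v ∨ arc k.succ.succ v (G.next v u)
  /-- The outer vertices are, counterclockwise around the drawing, a red, a blue and a green one,
  each with incoming edges of its own colour only. -/
  outer_color : ∃ X : Color → V, G.IsOuterFace (X .red) (X .green) (X .blue) ∧
    ∀ j k u, arc j u (X k) → j = k

/-- `T'` is obtained from `T` by flipping a directed triangle `a → b → c → a` that bounds a face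
(either clockwise or counterclockwise): the triangle is reversed, and each of its vertices keeps
the colour of its outgoing edge on the triangle.  All other edges are unchanged. -/
def FacialFlip {V : Type*} [Fintype V] {G : PlaneTriangulation V} (T T' : SchnyderWood G) : Prop :=
  ∃ (a b c : V) (i j k : Color), (G.IsFace a b c ∨ G.IsFace a c b) ∧
    (T.arc i a b ∧ T.arc j b c ∧ T.arc k c a) ∧
    (T'.arc i a c ∧ T'.arc j b a ∧ T'.arc k c b) ∧
    ∀ (m : Color) (u v : V),
      ¬ ((u = a ∨ u = b ∨ u = c) ∧ (v = a ∨ v = b ∨ v = c)) → (T'.arc m u v ↔ T.arc m u v)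

/-- `T'` can be obtained from `T` by a (possibly empty) sequence of facial flips. -/
def ObtainedByFacialFlips {V : Type*} [Fintype V] {G : PlaneTriangulation V}
    (T T' : SchnyderWood G) : Prop :=
  Relation.ReflTransGen FacialFlip T T'

/-! ### Right triangles -/

/-- The data of the triangle that is the lower-right half of the rectangle
`[left, right] × [bottom, top]`; see `RightTriangle.Proper`. -/
structure RightTriangle : Type where
  left : ℝ
  right : ℝ
  bottom : ℝ
  top : ℝ

namespace RightTriangle

/-- The rectangle has positive width and positive height. -/
def Proper (A : RightTriangle) : Prop := A.left < A.right ∧ A.bottom < A.top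

/-- The closed triangle: the points of the rectangle on or below the diagonal from
`(left, bottom)` to `(right, top)`. -/
def region (A : RightTriangle) : Set (ℝ × ℝ) :=
  {p | p.1 ≤ A.right ∧ A.bottom ≤ p.2 ∧
    (p.2 - A.bottom) * (A.right - A.left) ≤ (A.top - A.bottom) * (p.1 - A.left)}

/-- The top corner (red), the left corner (blue) and the right corner (green); this is their
counterclockwise order. -/
def corner (A : RightTriangle) : Color → ℝ × ℝ
  | .red => (A.right, A.top)
  | .blue => (A.left, A.bottom)
  | .green => (A.right, A.bottom)

/-- The side opposite to the corner of colour `k`, which is the side compatible with the corners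
of colour `k` of other triangles: the horizontal side for red (top corners), the vertical side
for blue (left corners), the diagonal side for green (right corners). -/
def side (A : RightTriangle) (k : Color) : Set (ℝ × ℝ) :=
  segment ℝ (A.corner k.succ) (A.corner k.succ.succ)

/-- A number for each corner, increasing in the counterclockwise order top, left, right. -/
def cornerPos : Color → ℝ
  | .red => 0
  | .blue => 3
  | .green => 6

/-- `A.HasPos B x`: going counterclockwise once around the boundary of `A`, from its top corner,
the triangle `B` is met at position `x`.
If a corner of `B` lies on the compatible side of `A`, then `B` counts as met on that
side; the sides (diagonal, horizontal, vertical) have the positions `[1, 2]`, `[4, 5]`, `[7, 8]`.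
Otherwise `B` is met at a corner of `A` that lies on a side of `B`; the corners (top, left, right)
have the positions `0`, `3`, `6`.  In particular, if three triangles have a common corner point,
then two of them are met by the third at the same point, but in the order in which they appear
around that point. -/
def HasPos (A B : RightTriangle) (x : ℝ) : Prop :=
  (∃ k : Color, ∃ s ∈ Set.Icc (0 : ℝ) 1,
    B.corner k = (1 - s) • A.corner k.succ + s • A.corner k.succ.succ ∧
      x = cornerPos k.succ + 1 + s) ∨
  ((∀ k, B.corner k ∉ A.side k) ∧ ∃ k, A.corner k ∈ B.side k ∧ x = cornerPos k)

/-- The triangle at time `s` when each corner moves from its position in `A` to its position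
in `B` with constant speed along a straight line. -/
def lerp (s : ℝ) (A B : RightTriangle) : RightTriangle where
  left := (1 - s) * A.left + s * B.left
  right := (1 - s) * A.right + s * B.right
  bottom := (1 - s) * A.bottom + s * B.bottom
  top := (1 - s) * A.top + s * B.top

theorem corner_lerp (s : ℝ) (A B : RightTriangle) (k : Color) :
    (lerp s A B).corner k = (1 - s) • A.corner k + s • B.corner k := by
  cases k <;> simp [lerp, corner]

end RightTriangle

/-- `y` is passed strictly between `x` and `z` when a circle is traversed in the direction of
increasing numbers. -/
def CyclicBetween (x y z : ℝ) : Prop :=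
  (x < y ∧ y < z) ∨ (y < z ∧ z < x) ∨ (z < x ∧ x < y)

/-! ### RT-representations and morphs -/

/-- `R` is an RT-representation (possibly a degenerate one) of the plane triangulation `G`. -/
structure IsRTRepresentation {V : Type*} [Fintype V] (G : PlaneTriangulation V)
    (R : V → RightTriangle) : Prop where
  proper : ∀ v, (R v).Proper
  /-- the triangles are internally disjoint -/
  disjoint : ∀ u v, u ≠ v → Disjoint (interior (R u).region) (interior (R v).region)
  /-- two triangles touch if and only if the vertices are adjacent -/
  touch : ∀ u v, u ≠ v → (((R u).region ∩ (R v).region).Nonempty ↔ G.graph.Adj u v)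
  /-- The same embedding: `G.next v u` is the neighbour of `v` that is met next after `u` when the
  boundary of the triangle of `v` is traversed counterclockwise. -/
  rotation : ∀ v u w, G.graph.Adj v u → G.graph.Adj v w → ∀ x y z,
    (R v).HasPos (R u) x → (R v).HasPos (R w) y → (R v).HasPos (R (G.next v u)) z →
      ¬ CyclicBetween x y z
  /-- The same outer face: the three outer triangles enclose all others, that is, no inner triangle
  meets an unbounded component of the complement of the three outer triangles. -/
  outer : ∀ v, ¬ G.IsOuter v → ∀ p ∈ (R v).region,
    Bornology.IsBounded (connectedComponentIn
      ((R G.outer₁).region ∪ (R G.outer₂).region ∪ (R G.outer₃).region)ᶜ p)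

/-- `⟨R, R'⟩` is a linear morph. -/
def LinearMorph {V : Type*} [Fintype V] (G : PlaneTriangulation V)
    (R R' : V → RightTriangle) : Prop :=
  ∀ s ∈ Set.Icc (0 : ℝ) 1, IsRTRepresentation G (fun v => (R v).lerp s (R' v))

/-- There is a piecewise linear morph between `R` and `R'`. -/
def PiecewiseLinearMorph {V : Type*} [Fintype V] (G : PlaneTriangulation V)
    (R R' : V → RightTriangle) : Prop :=
  ∃ (m : ℕ) (S : ℕ → V → RightTriangle), S 0 = R ∧ S m = R' ∧
    ∀ i < m, LinearMorph G (S i) (S (i + 1))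

/-- The Schnyder wood `T` corresponds to `R`: an edge that `T` orients from `u` to `v` and colours
with `k` is realized by the corner `k` of the triangle of `u` lying on the compatible
side of the triangle of `v`. -/
def Corresponds {V : Type*} [Fintype V] {G : PlaneTriangulation V}
    (R : V → RightTriangle) (T : SchnyderWood G) : Prop :=
  ∀ k u v, T.arc k u v → (R u).corner k ∈ (R v).side k

/-- `v` maximizes the y-coordinate of the horizontal side. -/
def IsTopmost {V : Type*} (R : V → RightTriangle) (v : V) : Prop :=
  ∀ u, (R u).bottom ≤ (R v).bottom

end RTMorph

namespace RTMorph

/-! Two touching, internally disjoint triangles share exactly one point, and there a corner of one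
lies on the compatible side of the other (`Separate.contact`). By Euler's formula there are 3(n - 3)
inner edges, as many as corners of inner triangles. Orienting every inner edge by one of its
contacts so that no corner is used twice therefore uses every corner once, and the rotation
condition turns such an arc system into a Schnyder wood (`IsArcSystem.toSchnyderWood`).

A choice of orientation exists only where corners coincide. Then three triangles have a red, a blue
and a green corner at one point, no fourth triangle touches that point, and the three bound a face
(`IsCornerTriple`). An arc system orients this face as a directed triangle in one of two ways.
Always choosing the same way gives a canonical wood (`CyclicArc`), which proves existence. Any other
wood corresponding to the same representation reaches it by flipping the wrongly oriented faces one
at a time (`flips_to_cyclicArc`), and flips are reversible.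

Along a linear morph, the times at which a fixed wood corresponds form a closed set, and finitely
many such sets cover the interval. Since the interval is connected, woods at its two ends are linked
by a chain in which consecutive woods correspond to the same representation at some time, hence by
flips (`rel_of_closed_cover`).

The topmost vertex is the outer vertex whose horizontal side bounds all inner triangles from above
(`IsFrame.isTopmost_iff`). Being topmost is also a closed condition, so the same covering argument
shows that this vertex cannot change. -/

theorem Color.succ_succ_succ (k : Color) : k.succ.succ.succ = k := by cases k <;> rfl

theorem Color.eq_or (j k : Color) : j = k ∨ j = k.succ ∨ j = k.succ.succ := by
  cases j <;> cases k <;> simp [Color.succ]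

theorem Color.succ_ne (k : Color) : k.succ ≠ k := by cases k <;> simp [Color.succ]

/-! ### Geometry of a single triangle and of the contact of two triangles. -/

namespace RightTriangle

/-- Nonnegative exactly on and below the line that carries the diagonal side. -/
def slack (A : RightTriangle) (p : ℝ × ℝ) : ℝ :=
  (A.top - A.bottom) * (p.1 - A.left) - (p.2 - A.bottom) * (A.right - A.left)

/-- The only point that two internally disjoint triangles can have in common. -/
def meet (A B : RightTriangle) : ℝ × ℝ := (min A.right B.right, max A.bottom B.bottom)

variable {A B : RightTriangle} {p q : ℝ × ℝ}

theorem mem_region : p ∈ A.region ↔ p.1 ≤ A.right ∧ A.bottom ≤ p.2 ∧ 0 ≤ A.slack p := by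
  simp [region, slack]

theorem continuous_slack (A : RightTriangle) : Continuous A.slack := by
  unfold slack; fun_prop

theorem slack_mono (hA : A.Proper) (h1 : p.1 ≤ q.1) (h2 : q.2 ≤ p.2) : A.slack p ≤ A.slack q := by
  obtain ⟨hw, hh⟩ := hA
  unfold slack
  nlinarith [mul_nonneg (sub_nonneg.2 hh.le) (sub_nonneg.2 h1),
    mul_nonneg (sub_nonneg.2 h2) (sub_nonneg.2 hw.le)]

theorem slack_strictMono_fst (hA : A.Proper) (h1 : p.1 < q.1) (h2 : q.2 ≤ p.2) :
    A.slack p < A.slack q := by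
  obtain ⟨hw, hh⟩ := hA
  unfold slack
  nlinarith [mul_pos (sub_pos.2 hh) (sub_pos.2 h1),
    mul_nonneg (sub_nonneg.2 h2) (sub_nonneg.2 hw.le)]

theorem slack_strictMono_snd (hA : A.Proper) (h1 : p.1 ≤ q.1) (h2 : q.2 < p.2) :
    A.slack p < A.slack q := by
  obtain ⟨hw, hh⟩ := hA
  unfold slack
  nlinarith [mul_nonneg (sub_nonneg.2 hh.le) (sub_nonneg.2 h1),
    mul_pos (sub_pos.2 h2) (sub_pos.2 hw)]

/-- `slack` grows strictly towards the lower right. Applied with a corner of slack zero, this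
identifies a point with that corner. -/
theorem eq_of_slack_le (hA : A.Proper) (h1 : p.1 ≤ q.1) (h2 : q.2 ≤ p.2)
    (h : A.slack q ≤ A.slack p) : p = q := by
  rcases h1.lt_or_eq with h1' | h1'
  · exact absurd h (slack_strictMono_fst hA h1' h2).not_ge
  rcases h2.lt_or_eq with h2' | h2'
  · exact absurd h (slack_strictMono_snd hA h1 h2').not_ge
  exact Prod.ext h1' h2'.symm

theorem slack_red (A : RightTriangle) : A.slack (A.right, A.top) = 0 := by
  simp only [slack]; ring

theorem slack_blue (A : RightTriangle) : A.slack (A.left, A.bottom) = 0 := by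
  simp only [slack]; ring

theorem slack_green_pos (hA : A.Proper) : 0 < A.slack (A.right, A.bottom) := by
  obtain ⟨hw, hh⟩ := hA
  simp only [slack]
  nlinarith [mul_pos (sub_pos.2 hw) (sub_pos.2 hh)]

theorem left_le_of_mem (hA : A.Proper) (hp : p ∈ A.region) : A.left ≤ p.1 := by
  obtain ⟨-, h2, h3⟩ := mem_region.1 hp
  by_contra! h
  have := slack_strictMono_fst (q := (A.left, A.bottom)) hA h h2
  rw [slack_blue] at this
  linarith

theorem le_top_of_mem (hA : A.Proper) (hp : p ∈ A.region) : p.2 ≤ A.top := by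
  obtain ⟨h1, -, h3⟩ := mem_region.1 hp
  by_contra! h
  have := slack_strictMono_snd (q := (A.right, A.top)) hA h1 h
  rw [slack_red] at this
  linarith

/-- The points strictly inside the three lines that carry the sides. -/
def strictRegion (A : RightTriangle) : Set (ℝ × ℝ) :=
  {p | p.1 < A.right ∧ A.bottom < p.2 ∧ 0 < A.slack p}

theorem isOpen_strictRegion (A : RightTriangle) : IsOpen A.strictRegion :=
  (isOpen_lt continuous_fst continuous_const).inter
    ((isOpen_lt continuous_const continuous_snd).inter
      (isOpen_lt continuous_const A.continuous_slack))

theorem strictRegion_subset_interior (A : RightTriangle) : A.strictRegion ⊆ interior A.region :=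
  interior_maximal (fun _ h => mem_region.2 ⟨h.1.le, h.2.1.le, h.2.2.le⟩) A.isOpen_strictRegion

theorem exists_mem_strictRegion (hA : A.Proper) : ∃ p, p ∈ A.strictRegion := by
  obtain ⟨hw, hh⟩ := hA
  refine ⟨((A.left + 3 * A.right) / 4, (3 * A.bottom + A.top) / 4), ?_, ?_, ?_⟩
  · simp only; linarith
  · simp only; linarith
  · simp only [slack]
    nlinarith [mul_pos (sub_pos.2 hw) (sub_pos.2 hh)]

/-- A proper triangle is the closure of its strict interior. Weak inequalities known at strictly
interior points thereby pass to the corners. -/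
theorem region_subset_of_isClosed (hA : A.Proper) {C : Set (ℝ × ℝ)} (hC : IsClosed C)
    (h : A.strictRegion ⊆ C) : A.region ⊆ C := by
  obtain ⟨m, hm⟩ := exists_mem_strictRegion hA
  intro q hq
  obtain ⟨h1, h2, h3⟩ := mem_region.1 hq
  have hlim : Filter.Tendsto (fun e : ℝ => ((1 - e) * q.1 + e * m.1, (1 - e) * q.2 + e * m.2))
      (nhdsWithin 0 (Set.Ioo 0 1)) (nhds q) := by
    have : Continuous (fun e : ℝ => ((1 - e) * q.1 + e * m.1, (1 - e) * q.2 + e * m.2)) := by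
      fun_prop
    have := this.tendsto 0
    simp only [sub_zero, one_mul, zero_mul, add_zero, Prod.mk.eta] at this
    exact this.mono_left nhdsWithin_le_nhds
  have : (nhdsWithin (0 : ℝ) (Set.Ioo 0 1)).NeBot := by
    rw [nhdsWithin_Ioo_eq_nhdsGT one_pos]; infer_instance
  refine hC.mem_of_tendsto hlim ?_
  filter_upwards [self_mem_nhdsWithin] with e he
  obtain ⟨he0, he1⟩ := he
  obtain ⟨g1, g2, g3⟩ := hm
  refine h ⟨?_, ?_, ?_⟩
  · simp only; nlinarith
  · simp only; nlinarith
  · have : A.slack ((1 - e) * q.1 + e * m.1, (1 - e) * q.2 + e * m.2) =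
        (1 - e) * A.slack q + e * A.slack m := by
      simp only [slack]; ring
    rw [this]
    have := mul_nonneg (sub_nonneg.2 he1.le) h3
    have := mul_pos he0 g3
    linarith

theorem mem_side_red (hA : A.Proper) :
    q ∈ A.side .red ↔ q.2 = A.bottom ∧ A.left ≤ q.1 ∧ q.1 ≤ A.right := by
  obtain ⟨hw, hh⟩ := hA
  simp only [side, Color.succ, corner, segment_eq_image, Set.mem_image, Set.mem_Icc]
  constructor
  · rintro ⟨s, ⟨h0, h1⟩, rfl⟩
    simp only [Prod.smul_mk, smul_eq_mul, Prod.mk_add_mk]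
    exact ⟨by ring, by nlinarith, by nlinarith⟩
  · rintro ⟨h1, h2, h3⟩
    have hw' : 0 < A.right - A.left := sub_pos.2 hw
    refine ⟨(q.1 - A.left) / (A.right - A.left), ⟨by apply div_nonneg <;> linarith,
      (div_le_one hw').2 (by linarith)⟩, ?_⟩
    ext
    · simp only [Prod.smul_mk, smul_eq_mul, Prod.mk_add_mk]; field_simp; ring
    · simp only [Prod.smul_mk, smul_eq_mul, Prod.mk_add_mk, h1]; ring

theorem mem_side_blue (hA : A.Proper) :
    q ∈ A.side .blue ↔ q.1 = A.right ∧ A.bottom ≤ q.2 ∧ q.2 ≤ A.top := by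
  obtain ⟨hw, hh⟩ := hA
  simp only [side, Color.succ, corner, segment_eq_image, Set.mem_image, Set.mem_Icc]
  constructor
  · rintro ⟨s, ⟨h0, h1⟩, rfl⟩
    simp only [Prod.smul_mk, smul_eq_mul, Prod.mk_add_mk]
    exact ⟨by ring, by nlinarith, by nlinarith⟩
  · rintro ⟨h1, h2, h3⟩
    have hw' : 0 < A.top - A.bottom := sub_pos.2 hh
    refine ⟨(q.2 - A.bottom) / (A.top - A.bottom), ⟨by apply div_nonneg <;> linarith,
      (div_le_one hw').2 (by linarith)⟩, ?_⟩
    ext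
    · simp only [Prod.smul_mk, smul_eq_mul, Prod.mk_add_mk, h1]; ring
    · simp only [Prod.smul_mk, smul_eq_mul, Prod.mk_add_mk]; field_simp; ring

theorem mem_side_green (hA : A.Proper) :
    q ∈ A.side .green ↔ A.slack q = 0 ∧ A.left ≤ q.1 ∧ q.1 ≤ A.right := by
  obtain ⟨hw, hh⟩ := hA
  simp only [side, Color.succ, corner, segment_eq_image, Set.mem_image, Set.mem_Icc]
  constructor
  · rintro ⟨s, ⟨h0, h1⟩, rfl⟩
    simp only [Prod.smul_mk, smul_eq_mul, Prod.mk_add_mk, slack]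
    exact ⟨by ring, by nlinarith, by nlinarith⟩
  · rintro ⟨h1, h2, h3⟩
    have hw' : 0 < A.right - A.left := sub_pos.2 hw
    refine ⟨(A.right - q.1) / (A.right - A.left), ⟨by apply div_nonneg <;> linarith,
      (div_le_one hw').2 (by linarith)⟩, ?_⟩
    simp only [slack] at h1
    ext
    · simp only [Prod.smul_mk, smul_eq_mul, Prod.mk_add_mk]; field_simp; ring
    · simp only [Prod.smul_mk, smul_eq_mul, Prod.mk_add_mk]; field_simp; linarith

theorem side_subset_region (hA : A.Proper) (k : Color) : A.side k ⊆ A.region := by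
  intro q hq
  rw [mem_region]
  cases k
  · rw [mem_side_red hA] at hq
    refine ⟨hq.2.2, hq.1.ge, ?_⟩
    rw [← A.slack_blue]
    exact slack_mono hA hq.2.1 hq.1.le
  · rw [mem_side_blue hA] at hq
    refine ⟨hq.1.le, hq.2.1, ?_⟩
    rw [← A.slack_red]
    exact slack_mono hA hq.1.ge hq.2.2
  · rw [mem_side_green hA] at hq
    refine ⟨hq.2.2, ?_, hq.1.ge⟩
    by_contra! h
    have := slack_strictMono_snd (p := (A.left, A.bottom)) hA hq.2.1 h
    rw [slack_blue, hq.1] at this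
    exact lt_irrefl _ this

theorem corner_mem_side_succ (A : RightTriangle) (k : Color) : A.corner k ∈ A.side k.succ := by
  cases k <;> exact right_mem_segment ℝ _ _

theorem corner_mem_side_succ_succ (A : RightTriangle) (k : Color) :
    A.corner k ∈ A.side k.succ.succ := by
  cases k <;> exact left_mem_segment ℝ _ _

theorem corner_mem_side (A : RightTriangle) {j k : Color} (h : j ≠ k) :
    A.corner j ∈ A.side k := by
  rcases Color.eq_or k j with rfl | rfl | rfl
  · exact absurd rfl h
  · exact A.corner_mem_side_succ j
  · exact A.corner_mem_side_succ_succ j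

theorem corner_mem_region (hA : A.Proper) (k : Color) : A.corner k ∈ A.region :=
  side_subset_region hA _ (A.corner_mem_side_succ k)

theorem corner_notMem_side (hA : A.Proper) (k : Color) : A.corner k ∉ A.side k := by
  cases k
  · rw [mem_side_red hA]; simp only [corner]; rintro ⟨h, -⟩; linarith [hA.2]
  · rw [mem_side_blue hA]; simp only [corner]; rintro ⟨h, -⟩; linarith [hA.1]
  · rw [mem_side_green hA]; simp only [corner]; rintro ⟨h, -⟩; linarith [slack_green_pos hA]

theorem corner_injective (hA : A.Proper) {j k : Color} (h : A.corner j = A.corner k) : j = k := by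
  by_contra hjk
  exact corner_notMem_side hA k (h ▸ A.corner_mem_side hjk)

/-- Two different sides have only their common corner in common. -/
theorem eq_corner_of_mem_side (hA : A.Proper) {k : Color} (h1 : p ∈ A.side k.succ)
    (h2 : p ∈ A.side k.succ.succ) : p = A.corner k := by
  cases k <;> simp only [Color.succ, mem_side_red hA, mem_side_blue hA, mem_side_green hA] at h1 h2
  · refine (eq_of_slack_le hA (q := p) (p := (A.right, A.top)) h1.1.ge h1.2.2 ?_).symm
    rw [slack_red]; exact h2.1.le
  · refine eq_of_slack_le hA (q := (A.left, A.bottom)) (p := p) ?_ h2.1.ge ?_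
    · by_contra! h
      have := slack_strictMono_fst (p := (A.left, A.bottom)) hA h h2.1.le
      rw [slack_blue, h1.1] at this
      exact lt_irrefl _ this
    · rw [slack_blue]; exact h1.1.ge
  · exact Prod.ext h2.1 h1.1

/-- Two proper triangles with disjoint interiors. -/
structure Separate (A B : RightTriangle) : Prop where
  left : A.Proper
  right : B.Proper
  disj : Disjoint (interior A.region) (interior B.region)

theorem Separate.symm (h : Separate A B) : Separate B A := ⟨h.right, h.left, h.disj.symm⟩

/-- With both slacks positive at `meet`, a small step up and to the left would lead into both open
triangles. -/
theorem Separate.slack_meet_nonpos (h : Separate A B) :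
    A.slack (A.meet B) ≤ 0 ∨ B.slack (A.meet B) ≤ 0 := by
  by_contra! hc
  obtain ⟨h1, h2⟩ := hc
  have hcont : Continuous (fun e : ℝ => ((A.meet B).1 - e, (A.meet B).2 + e)) := by fun_prop
  have hz : ((A.meet B).1 - 0, (A.meet B).2 + 0) = A.meet B := by simp
  have hA := (A.continuous_slack.comp hcont).tendsto 0
  have hB := (B.continuous_slack.comp hcont).tendsto 0
  simp only [Function.comp, hz] at hA hB
  have ev := (hA.eventually (lt_mem_nhds h1)).and (hB.eventually (lt_mem_nhds h2))
  obtain ⟨e, he, he0⟩ := ((ev.filter_mono nhdsWithin_le_nhds).and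
    (self_mem_nhdsWithin : Set.Ioi (0 : ℝ) ∈ nhdsWithin 0 (Set.Ioi 0))).exists
  have he0 : 0 < e := he0
  refine Set.disjoint_left.1 h.disj (A.strictRegion_subset_interior ⟨?_, ?_, he.1⟩)
    (B.strictRegion_subset_interior ⟨?_, ?_, he.2⟩)
  · have := min_le_left A.right B.right; simp only [meet]; linarith
  · have := le_max_left A.bottom B.bottom; simp only [meet]; linarith
  · have := min_le_right A.right B.right; simp only [meet]; linarith
  · have := le_max_right A.bottom B.bottom; simp only [meet]; linarith

/-- A common point lies weakly above and to the left of `meet`. In a triangle whose slack at `meet`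
is not positive, slack would become negative on moving further that way. -/
theorem Separate.eq_meet (h : Separate A B) (hA : p ∈ A.region) (hB : p ∈ B.region) :
    p = A.meet B ∧ (A.slack p = 0 ∨ B.slack p = 0) := by
  obtain ⟨a1, a2, a3⟩ := mem_region.1 hA
  obtain ⟨b1, b2, b3⟩ := mem_region.1 hB
  have hx : p.1 ≤ (A.meet B).1 := le_min a1 b1
  have hy : (A.meet B).2 ≤ p.2 := max_le a2 b2
  rcases h.slack_meet_nonpos with hm | hm
  · have := eq_of_slack_le h.left hx hy (hm.trans a3)
    exact ⟨this, Or.inl (le_antisymm (this ▸ hm) a3)⟩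
  · have := eq_of_slack_le h.right hx hy (hm.trans b3)
    exact ⟨this, Or.inr (le_antisymm (this ▸ hm) b3)⟩

theorem Separate.eq_of_mem (h : Separate A B) (hA : p ∈ A.region) (hB : p ∈ B.region)
    (hA' : q ∈ A.region) (hB' : q ∈ B.region) : p = q :=
  (h.eq_meet hA hB).1.trans (h.eq_meet hA' hB').1.symm

/-- Let the slack vanish in `A`. The coordinates of `p` are a `right` and a `bottom`, each of `A` or
of `B`. If `p` has the abscissa `A.right`, it is the top corner of `A`; otherwise, if it has the
ordinate `A.bottom`, it is the left corner of `A`. If both coordinates come from `B` only, it is the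
right corner of `B` on the diagonal of `A`. -/
theorem Separate.contact (h : Separate A B) (hA : p ∈ A.region) (hB : p ∈ B.region) :
    (∃ k, A.corner k = p ∧ p ∈ B.side k) ∨ (∃ k, B.corner k = p ∧ p ∈ A.side k) := by
  wlog hs : A.slack p = 0 generalizing A B
  · exact (this h.symm hB hA (((h.eq_meet hA hB).2).resolve_left hs)).symm
  obtain ⟨a1, a2, a3⟩ := mem_region.1 hA
  obtain ⟨b1, b2, b3⟩ := mem_region.1 hB
  have hm := (h.eq_meet hA hB).1
  have hx : p.1 = min A.right B.right := congrArg Prod.fst hm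
  have hy : p.2 = max A.bottom B.bottom := congrArg Prod.snd hm
  have hl := left_le_of_mem h.right hB
  have ht := le_top_of_mem h.right hB
  have hl' := left_le_of_mem h.left hA
  by_cases hr : p.1 = A.right
  · have hp : p = (A.right, A.top) := by
      refine (eq_of_slack_le h.left (p := (A.right, A.top)) (q := p) hr.ge
        (le_top_of_mem h.left hA) ?_).symm
      rw [hs, slack_red]
    refine Or.inl ⟨.red, hp.symm, (mem_side_red h.right).2 ⟨?_, hl, b1⟩⟩
    rcases max_choice A.bottom B.bottom with hc | hc
    · rw [hc, hp] at hy
      exact absurd hy h.left.2.ne'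
    · rw [hy, hc]
  · have hr' : p.1 = B.right := by
      rcases min_choice A.right B.right with hc | hc
      · exact absurd (hx.trans hc) hr
      · exact hx.trans hc
    by_cases hb : p.2 = A.bottom
    · have hp : p = (A.left, A.bottom) := by
        refine (eq_of_slack_le h.left (p := (A.left, A.bottom)) (q := p) hl' hb.le ?_).symm
        rw [hs, slack_blue]
      exact Or.inl ⟨.blue, hp.symm, (mem_side_blue h.right).2 ⟨hr', b2, ht⟩⟩
    · have hb' : p.2 = B.bottom := by
        rcases max_choice A.bottom B.bottom with hc | hc
        · exact absurd (hy.trans hc) hb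
        · exact hy.trans hc
      exact Or.inr ⟨.green, (Prod.ext hr' hb').symm, (mem_side_green h.left).2 ⟨hs, hl', a1⟩⟩

/-- The common point would be `meet`: a `top` cannot equal a `bottom`, nor a `left` a `right`, and
at a common right corner both slacks would be positive. -/
theorem Separate.corner_ne (h : Separate A B) (k : Color) : A.corner k ≠ B.corner k := by
  intro hk
  have hw := h.left.1
  have hh := h.left.2
  have hw' := h.right.1
  have hh' := h.right.2
  have h1 := h.eq_meet (corner_mem_region h.left k) (hk ▸ corner_mem_region h.right k)
  obtain ⟨h1, h2⟩ := h1
  cases k <;> simp only [corner, meet, Prod.mk.injEq] at h1 hk h2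
  · rcases max_choice A.bottom B.bottom with hc | hc <;> rw [hc] at h1 <;> linarith
  · rcases min_choice A.right B.right with hc | hc <;> rw [hc] at h1 <;> linarith
  · have e1 := slack_green_pos h.left
    have e2 := slack_green_pos h.right
    rw [← hk.1, ← hk.2] at e2
    rcases h2 with h2 | h2 <;> linarith

/-- A common point of two compatible sides is a corner of both triangles. -/
theorem Separate.corners_of_mem_side (h : Separate A B) {k : Color} (hA : p ∈ A.side k)
    (hB : p ∈ B.side k) :
    (A.corner k.succ = p ∧ B.corner k.succ.succ = p) ∨
      (A.corner k.succ.succ = p ∧ B.corner k.succ = p) := by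
  wlog hc : ∃ j, A.corner j = p ∧ p ∈ B.side j generalizing A B
  · have hc' := (h.contact (side_subset_region h.left k hA)
      (side_subset_region h.right k hB)).resolve_left hc
    exact (this h.symm hB hA hc').symm.imp And.symm And.symm
  obtain ⟨j, hj, hjB⟩ := hc
  rcases Color.eq_or j k with rfl | rfl | rfl
  · exact absurd (hj ▸ hA) (corner_notMem_side h.left _)
  · refine Or.inl ⟨hj, (eq_corner_of_mem_side h.right ?_ ?_).symm⟩
    · rwa [Color.succ_succ_succ]
    · rwa [Color.succ_succ_succ]
  · refine Or.inr ⟨hj, (eq_corner_of_mem_side h.right hjB ?_).symm⟩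
    rwa [Color.succ_succ_succ]

theorem Separate.notMem_strictRegion (h : Separate A B) (hA : p ∈ A.strictRegion) :
    p ∉ B.region := by
  intro hB
  have hA' : p ∈ A.region := interior_subset (A.strictRegion_subset_interior hA)
  rcases h.contact hA' hB with ⟨k, hk, -⟩ | ⟨k, -, hk⟩
  · subst hk
    obtain ⟨h1, h2, h3⟩ := hA
    cases k <;> simp only [corner] at h1 h2 h3 <;> exact lt_irrefl _ ‹_›
  · obtain ⟨h1, h2, h3⟩ := hA
    cases k
    · rw [mem_side_red h.left] at hk; linarith
    · rw [mem_side_blue h.left] at hk; linarith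
    · rw [mem_side_green h.left] at hk; linarith

end RightTriangle

/-! ### The frame formed by the three outer triangles. -/

open RightTriangle

theorem not_isBounded_connectedComponentIn_of_ray {F : Set (ℝ × ℝ)} {p d : ℝ × ℝ} (hd : d ≠ 0)
    (h : ∀ t : ℝ, 0 ≤ t → p + t • d ∈ F) :
    ¬ Bornology.IsBounded (connectedComponentIn F p) := by
  intro hb
  have hcont : Continuous (fun t : ℝ => p + t • d) := by fun_prop
  have hsub : (fun t : ℝ => p + t • d) '' Set.Ici 0 ⊆ connectedComponentIn F p := by
    refine (isPreconnected_Ici.image _ hcont.continuousOn).subset_connectedComponentIn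
      ⟨0, by simp, by simp⟩ ?_
    rintro _ ⟨t, ht, rfl⟩
    exact h t ht
  obtain ⟨C, hC⟩ := isBounded_iff_forall_norm_le.1 hb
  have hd' : 0 < ‖d‖ := norm_pos_iff.2 hd
  have hC0 : 0 ≤ C := (norm_nonneg p).trans (hC p (hsub ⟨0, by simp, by simp⟩))
  have ht : 0 ≤ (C + ‖p‖ + 1) / ‖d‖ := by positivity
  have h1 := hC _ (hsub ⟨_, ht, rfl⟩)
  have h2 := norm_sub_le (p + ((C + ‖p‖ + 1) / ‖d‖) • d) p
  simp only at h1
  rw [add_sub_cancel_left, norm_smul, Real.norm_of_nonneg ht, div_mul_cancel₀ _ hd'.ne'] at h2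
  linarith

variable {V : Type*} [Fintype V] {G : PlaneTriangulation V} {R : V → RightTriangle}

namespace PlaneTriangulation

theorem adj_outer₂₃ (G : PlaneTriangulation V) : G.graph.Adj G.outer₂ G.outer₃ :=
  G.outer_next ▸ (G.face_triangle _ _ G.outer_adj).1

theorem adj_outer₁₃ (G : PlaneTriangulation V) : G.graph.Adj G.outer₁ G.outer₃ :=
  G.outer_next ▸ G.adj_next _ _ G.outer_adj

theorem isOuter_iff_of_ne (G : PlaneTriangulation V) {a b c : V} (ha : G.IsOuter a)
    (hb : G.IsOuter b) (hc : G.IsOuter c) (hab : a ≠ b) (hac : a ≠ c) (hbc : b ≠ c) (v : V) :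
    G.IsOuter v ↔ v = a ∨ v = b ∨ v = c := by
  unfold IsOuter at *
  grind

theorem adj_of_isOuter (G : PlaneTriangulation V) {a b : V} (ha : G.IsOuter a)
    (hb : G.IsOuter b) (hab : a ≠ b) : G.graph.Adj a b := by
  have h1 := G.outer_adj
  have h2 := G.adj_outer₂₃
  have h3 := G.adj_outer₁₃
  rcases ha with rfl | rfl | rfl <;> rcases hb with rfl | rfl | rfl <;>
    first
    | exact absurd rfl hab
    | assumption
    | (apply SimpleGraph.Adj.symm; assumption)

end PlaneTriangulation

theorem IsRTRepresentation.separate (hR : IsRTRepresentation G R) {u v : V} (h : u ≠ v) :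
    Separate (R u) (R v) := ⟨hR.proper u, hR.proper v, hR.disjoint u v h⟩

theorem IsRTRepresentation.contact (hR : IsRTRepresentation G R) {u v : V}
    (h : G.graph.Adj u v) :
    (∃ k, (R u).corner k ∈ (R v).side k) ∨ (∃ k, (R v).corner k ∈ (R u).side k) := by
  obtain ⟨p, hu, hv⟩ := (hR.touch u v h.ne).2 h
  rcases (hR.separate h.ne).contact hu hv with ⟨k, rfl, hk⟩ | ⟨k, rfl, hk⟩
  · exact Or.inl ⟨k, hk⟩
  · exact Or.inr ⟨k, hk⟩

theorem IsRTRepresentation.adj_of_corner_mem (hR : IsRTRepresentation G R) {u v : V} (h : u ≠ v)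
    {k : Color} (hk : (R u).corner k ∈ (R v).region) : G.graph.Adj u v :=
  (hR.touch u v h).1 ⟨_, corner_mem_region (hR.proper u) k, hk⟩

/-- The point `p` is seen from below by the horizontal side of `A`, from the right by the vertical
side of `B`, and both from above and from the left by the diagonal side of `C`. -/
structure Encloses (A B C : RightTriangle) (p : ℝ × ℝ) : Prop where
  left_red : A.left ≤ p.1
  right_red : p.1 ≤ A.right
  bottom_red : p.2 < A.bottom
  right_blue : B.right < p.1
  bottom_blue : B.bottom ≤ p.2
  top_blue : p.2 ≤ B.top
  left_green : C.left ≤ p.1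
  right_green : p.1 ≤ C.right
  bottom_green : C.bottom ≤ p.2
  top_green : p.2 ≤ C.top
  slack_green : C.slack p < 0

/-- A ray that avoids the outer triangles would lie in a single component of their complement and
make it unbounded. -/
theorem IsRTRepresentation.exists_ray_mem (hR : IsRTRepresentation G R) {x : V}
    (hx : ¬ G.IsOuter x) {p : ℝ × ℝ} (hp : p ∈ (R x).strictRegion) {d : ℝ × ℝ} (hd : d ≠ 0) :
    ∃ v, G.IsOuter v ∧ p ∉ (R v).region ∧ ∃ t : ℝ, 0 ≤ t ∧ p + t • d ∈ (R v).region := by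
  by_contra! hc
  refine not_isBounded_connectedComponentIn_of_ray hd ?_
    (hR.outer x hx p (interior_subset ((R x).strictRegion_subset_interior hp)))
  intro t ht
  have key : ∀ v, G.IsOuter v → p + t • d ∉ (R v).region := fun v hv =>
    hc v hv ((hR.separate (by rintro rfl; exact hx hv)).notMem_strictRegion hp) t ht
  rintro ((h | h) | h)
  · exact key _ (Or.inl rfl) h
  · exact key _ (Or.inr (Or.inl rfl)) h
  · exact key _ (Or.inr (Or.inr rfl)) h

/-- The rays upwards, to the left and downwards hit three different outer triangles, which become
`r`, `b` and `g`. The ray to the right supplies the vertical bounds for `g`. -/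
theorem IsRTRepresentation.exists_encloses (hR : IsRTRepresentation G R) {x : V}
    (hx : ¬ G.IsOuter x) {p : ℝ × ℝ} (hp : p ∈ (R x).strictRegion) :
    ∃ r b g, (∀ v, G.IsOuter v ↔ v = r ∨ v = b ∨ v = g) ∧ Encloses (R r) (R b) (R g) p := by
  obtain ⟨r, hr, hrp, t₁, ht₁, h₁⟩ := hR.exists_ray_mem hx hp (d := (0, 1)) (by simp)
  obtain ⟨b, hb, hbp, t₂, ht₂, h₂⟩ := hR.exists_ray_mem hx hp (d := (-1, 0)) (by simp)
  obtain ⟨g, hg, hgp, t₃, ht₃, h₃⟩ := hR.exists_ray_mem hx hp (d := (0, -1)) (by simp)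
  obtain ⟨g', hg', hgp', t₄, ht₄, h₄⟩ := hR.exists_ray_mem hx hp (d := (1, 0)) (by simp)
  have l₁ := left_le_of_mem (hR.proper r) h₁
  have l₂ := le_top_of_mem (hR.proper b) h₂
  have l₃ := left_le_of_mem (hR.proper g) h₃
  have l₄ := le_top_of_mem (hR.proper g') h₄
  rw [mem_region] at h₁ h₂ h₃ h₄ hrp hbp hgp hgp'
  have s₁ := slack_mono (hR.proper r) (p := p + t₁ • (0, 1)) (q := p) (by simp) (by simpa)
  have s₂ := slack_mono (hR.proper b) (p := p + t₂ • (-1, 0)) (q := p) (by simpa) (by simp)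
  simp only [Prod.smul_mk, smul_eq_mul, mul_zero, mul_one, Prod.fst_add, Prod.snd_add, add_zero,
    mul_neg] at h₁ h₂ h₃ h₄ l₁ l₂ l₃ l₄ s₁ s₂
  -- Going back down from the hit point only increases the slack, so `p` can be outside only by
  -- being too low. The case of `b` is analogous.
  have e₁ : p.2 < (R r).bottom := by
    by_contra! h
    exact hrp ⟨h₁.1, h, h₁.2.2.trans s₁⟩
  have e₂ : (R b).right < p.1 := by
    by_contra! h
    exact hbp ⟨h, h₂.2.1, h₂.2.2.trans s₂⟩
  have e₃ : (R g).slack p < 0 := by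
    by_contra! h
    exact hgp ⟨h₃.1, by linarith, h⟩
  have hrb : r ≠ b := by rintro rfl; linarith
  have hrg : r ≠ g := by rintro rfl; linarith
  have hbg : b ≠ g := by rintro rfl; linarith
  have hout := G.isOuter_iff_of_ne hr hb hg hrb hrg hbg
  have hgg : g' = g := by
    rcases (hout g').1 hg' with rfl | rfl | rfl
    · linarith
    · linarith
    · rfl
  subst hgg
  exact ⟨r, b, g', hout, l₁, h₁.1, e₁, e₂, h₂.2.1, l₂, l₃, h₃.1, h₄.2.1, l₄, e₃⟩

/-- The roles do not depend on the point: `r` has the largest `bottom` of the three outer triangles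
and `b` the smallest `right`. -/
theorem Encloses.unique {r b g r' b' g' : V} {p q : ℝ × ℝ} (h : Encloses (R r) (R b) (R g) p)
    (h' : Encloses (R r') (R b') (R g') q) (ho : ∀ v, G.IsOuter v ↔ v = r ∨ v = b ∨ v = g)
    (ho' : ∀ v, G.IsOuter v ↔ v = r' ∨ v = b' ∨ v = g') : r' = r ∧ b' = b ∧ g' = g := by
  have h1 := h.bottom_red; have h2 := h.bottom_blue; have h3 := h.bottom_green
  have h4 := h.right_red; have h5 := h.right_blue; have h6 := h.right_green
  have k1 := h'.bottom_red; have k2 := h'.bottom_blue; have k3 := h'.bottom_green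
  have k4 := h'.right_red; have k5 := h'.right_blue; have k6 := h'.right_green
  have a1 := (ho' r).1 ((ho r).2 (by simp))
  have a2 := (ho' b).1 ((ho b).2 (by simp))
  have a3 := (ho' g).1 ((ho g).2 (by simp))
  have b1 := (ho r').1 ((ho' r').2 (by simp))
  have b2 := (ho b').1 ((ho' b').2 (by simp))
  have hr : r' = r := by
    rcases b1 with rfl | rfl | rfl
    · rfl
    · rcases a1 with rfl | rfl | rfl <;> linarith
    · rcases a1 with rfl | rfl | rfl <;> linarith
  have hb : b' = b := by
    rcases b2 with rfl | rfl | rfl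
    · rcases a2 with rfl | rfl | rfl <;> linarith
    · rfl
    · rcases a2 with rfl | rfl | rfl <;> linarith
  subst hr hb
  refine ⟨rfl, rfl, ?_⟩
  rcases a3 with rfl | rfl | rfl
  · linarith
  · linarith
  · rfl

/-- `r`, `b`, `g` are the outer vertices, and their triangles enclose all others, with the
horizontal side of `r`, the vertical side of `b` and the diagonal side of `g`. -/
structure IsFrame (G : PlaneTriangulation V) (R : V → RightTriangle) (r b g : V) : Prop where
  isOuter_iff : ∀ v, G.IsOuter v ↔ v = r ∨ v = b ∨ v = g
  bottom_blue_lt : (R b).bottom < (R r).bottom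
  bottom_green_lt : (R g).bottom < (R r).bottom
  right_green_lt : (R b).right < (R g).right
  left_red : ∀ x, ¬ G.IsOuter x → (R r).left ≤ (R x).left
  right_red : ∀ x, ¬ G.IsOuter x → (R x).right ≤ (R r).right
  bottom_red : ∀ x, ¬ G.IsOuter x → (R x).top ≤ (R r).bottom
  right_blue : ∀ x, ¬ G.IsOuter x → (R b).right ≤ (R x).left
  bottom_blue : ∀ x, ¬ G.IsOuter x → (R b).bottom ≤ (R x).bottom
  top_blue : ∀ x, ¬ G.IsOuter x → (R x).top ≤ (R b).top
  left_green : ∀ x, ¬ G.IsOuter x → (R g).left ≤ (R x).left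
  right_green : ∀ x, ¬ G.IsOuter x → (R x).right ≤ (R g).right
  bottom_green : ∀ x, ¬ G.IsOuter x → (R g).bottom ≤ (R x).bottom
  top_green : ∀ x, ¬ G.IsOuter x → (R x).top ≤ (R g).top
  slack_green : ∀ x, ¬ G.IsOuter x → (R g).slack ((R x).right, (R x).bottom) ≤ 0

theorem IsRTRepresentation.exists_frame (hR : IsRTRepresentation G R)
    (hin : ∃ x, ¬ G.IsOuter x) : ∃ r b g, IsFrame G R r b g := by
  obtain ⟨x₀, hx₀⟩ := hin
  obtain ⟨p₀, hp₀⟩ := exists_mem_strictRegion (hR.proper x₀)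
  obtain ⟨r, b, g, hout, henc⟩ := hR.exists_encloses hx₀ hp₀
  have key : ∀ x, ¬ G.IsOuter x → ∀ p ∈ (R x).strictRegion, Encloses (R r) (R b) (R g) p := by
    intro x hx p hp
    obtain ⟨r', b', g', hout', henc'⟩ := hR.exists_encloses hx hp
    obtain ⟨rfl, rfl, rfl⟩ := henc.unique henc' hout hout'
    exact henc'
  have corner : ∀ x, ¬ G.IsOuter x → ∀ k, ∀ f : ℝ × ℝ → ℝ, ∀ c, Continuous f →
      (∀ p, Encloses (R r) (R b) (R g) p → f p ≤ c) → f ((R x).corner k) ≤ c :=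
    fun x hx k f c hf h => region_subset_of_isClosed (hR.proper x)
      (isClosed_le hf (continuous_const (y := c))) (fun p hp => h p (key x hx p hp))
      (corner_mem_region (hR.proper x) k)
  have corner' : ∀ x, ¬ G.IsOuter x → ∀ k, ∀ f : ℝ × ℝ → ℝ, ∀ c, Continuous f →
      (∀ p, Encloses (R r) (R b) (R g) p → c ≤ f p) → c ≤ f ((R x).corner k) :=
    fun x hx k f c hf h => neg_le_neg_iff.1
      (corner x hx k (fun p => - f p) (-c) hf.neg fun p hp => neg_le_neg (h p hp))
  exact ⟨r, b, g, {
    isOuter_iff := hout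
    bottom_blue_lt := henc.bottom_blue.trans_lt henc.bottom_red
    bottom_green_lt := henc.bottom_green.trans_lt henc.bottom_red
    right_green_lt := henc.right_blue.trans_le henc.right_green
    left_red := fun x hx => corner' x hx .blue Prod.fst _ continuous_fst fun p h => h.left_red
    right_red := fun x hx => corner x hx .red Prod.fst _ continuous_fst fun p h => h.right_red
    bottom_red := fun x hx => corner x hx .red Prod.snd _ continuous_snd
      fun p h => h.bottom_red.le
    right_blue := fun x hx => corner' x hx .blue Prod.fst _ continuous_fst
      fun p h => h.right_blue.le
    bottom_blue := fun x hx => corner' x hx .blue Prod.snd _ continuous_snd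
      fun p h => h.bottom_blue
    top_blue := fun x hx => corner x hx .red Prod.snd _ continuous_snd fun p h => h.top_blue
    left_green := fun x hx => corner' x hx .blue Prod.fst _ continuous_fst
      fun p h => h.left_green
    right_green := fun x hx => corner x hx .red Prod.fst _ continuous_fst
      fun p h => h.right_green
    bottom_green := fun x hx => corner' x hx .blue Prod.snd _ continuous_snd
      fun p h => h.bottom_green
    top_green := fun x hx => corner x hx .red Prod.snd _ continuous_snd fun p h => h.top_green
    slack_green := fun x hx => corner x hx .green (R g).slack _ (R g).continuous_slack
      fun p h => h.slack_green.le }⟩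

namespace IsFrame

variable {r b g : V}

theorem ne_rb (hF : IsFrame G R r b g) : r ≠ b := by
  rintro rfl; exact lt_irrefl _ hF.bottom_blue_lt

theorem ne_rg (hF : IsFrame G R r b g) : r ≠ g := by
  rintro rfl; exact lt_irrefl _ hF.bottom_green_lt

theorem ne_bg (hF : IsFrame G R r b g) : b ≠ g := by
  rintro rfl; exact lt_irrefl _ hF.right_green_lt

theorem isOuter_r (hF : IsFrame G R r b g) : G.IsOuter r := (hF.isOuter_iff r).2 (by simp)
theorem isOuter_b (hF : IsFrame G R r b g) : G.IsOuter b := (hF.isOuter_iff b).2 (by simp)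
theorem isOuter_g (hF : IsFrame G R r b g) : G.IsOuter g := (hF.isOuter_iff g).2 (by simp)

/-- Inner triangles have positive height and end at or below the horizontal side of `r`. -/
theorem isTopmost_iff (hF : IsFrame G R r b g) (hR : IsRTRepresentation G R) (u : V) :
    IsTopmost R u ↔ u = r := by
  have h : ∀ v, v ≠ r → (R v).bottom < (R r).bottom := by
    intro v hv
    by_cases ho : G.IsOuter v
    · rcases (hF.isOuter_iff v).1 ho with rfl | rfl | rfl
      · exact absurd rfl hv
      · exact hF.bottom_blue_lt
      · exact hF.bottom_green_lt
    · exact (hR.proper v).2.trans_le (hF.bottom_red v ho)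
  constructor
  · intro hu
    by_contra hne
    exact (h u hne).not_ge (hu r)
  · rintro rfl v
    by_cases hv : v = u
    · rw [hv]
    · exact (h v hv).le

theorem slack_green_red_neg (hF : IsFrame G R r b g) (hR : IsRTRepresentation G R) {x : V}
    (hx : ¬ G.IsOuter x) : (R g).slack ((R x).right, (R x).top) < 0 :=
  (slack_strictMono_snd (hR.proper g) (p := ((R x).right, (R x).top))
    (q := ((R x).right, (R x).bottom)) le_rfl (hR.proper x).2).trans_le (hF.slack_green x hx)

theorem slack_green_blue_neg (hF : IsFrame G R r b g) (hR : IsRTRepresentation G R) {x : V}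
    (hx : ¬ G.IsOuter x) : (R g).slack ((R x).left, (R x).bottom) < 0 :=
  (slack_strictMono_fst (hR.proper g) (p := ((R x).left, (R x).bottom))
    (q := ((R x).right, (R x).bottom)) (hR.proper x).1 le_rfl).trans_le (hF.slack_green x hx)

/-- Inside the frame there is room for an inner triangle of positive size. This rules out four of
the six possible contacts, here and for the other two outer edges. -/
theorem contact_rg (hF : IsFrame G R r b g) (hR : IsRTRepresentation G R)
    (hin : ∃ x, ¬ G.IsOuter x) :
    (R r).corner .green ∈ (R g).side .green ∨ (R g).corner .red ∈ (R r).side .red := by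
  obtain ⟨x, hx⟩ := hin
  have h1 := hF.left_red x hx
  have h2 := hF.right_red x hx
  have h3 := hF.bottom_red x hx
  have h4 := hF.left_green x hx
  have h5 := hF.right_green x hx
  have h6 := hF.bottom_green x hx
  obtain ⟨hw, hh⟩ := hR.proper x
  obtain ⟨hw', hh'⟩ := hR.proper r
  rcases hR.contact (G.adj_of_isOuter hF.isOuter_r hF.isOuter_g hF.ne_rg) with
    ⟨k, hk⟩ | ⟨k, hk⟩ <;> cases k
  · rw [mem_side_red (hR.proper g)] at hk; simp only [corner] at hk; linarith
  · rw [mem_side_blue (hR.proper g)] at hk; simp only [corner] at hk; linarith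
  · exact Or.inl hk
  · exact Or.inr hk
  · rw [mem_side_blue (hR.proper r)] at hk; simp only [corner] at hk; linarith
  · have := (mem_region.1 (side_subset_region (hR.proper r) _ hk)).2.1
    simp only [corner] at this; linarith

theorem contact_bg (hF : IsFrame G R r b g) (hR : IsRTRepresentation G R)
    (hin : ∃ x, ¬ G.IsOuter x) :
    (R b).corner .green ∈ (R g).side .green ∨ (R g).corner .blue ∈ (R b).side .blue := by
  obtain ⟨x, hx⟩ := hin
  have h1 := hF.right_blue x hx
  have h2 := hF.bottom_blue x hx
  have h3 := hF.top_blue x hx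
  have h4 := hF.right_green x hx
  have h5 := hF.bottom_green x hx
  have h6 := hF.top_green x hx
  obtain ⟨hw, hh⟩ := hR.proper x
  obtain ⟨hw', hh'⟩ := hR.proper b
  rcases hR.contact (G.adj_of_isOuter hF.isOuter_b hF.isOuter_g hF.ne_bg) with
    ⟨k, hk⟩ | ⟨k, hk⟩ <;> cases k
  · rw [mem_side_red (hR.proper g)] at hk; simp only [corner] at hk; linarith
  · rw [mem_side_blue (hR.proper g)] at hk; simp only [corner] at hk; linarith
  · exact Or.inl hk
  · rw [mem_side_red (hR.proper b)] at hk; simp only [corner] at hk; linarith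
  · exact Or.inr hk
  · have := (mem_region.1 (side_subset_region (hR.proper b) _ hk)).1
    simp only [corner] at this; linarith

theorem contact_rb (hF : IsFrame G R r b g) (hR : IsRTRepresentation G R)
    (hin : ∃ x, ¬ G.IsOuter x) :
    (R r).corner .blue ∈ (R b).side .blue ∨ (R b).corner .red ∈ (R r).side .red := by
  obtain ⟨x, hx⟩ := hin
  have h1 := hF.right_blue x hx
  have h2 := hF.bottom_blue x hx
  have h3 := hF.bottom_red x hx
  have h4 := hF.right_red x hx
  obtain ⟨hw, hh⟩ := hR.proper x
  obtain ⟨hw', hh'⟩ := hR.proper b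
  obtain ⟨hw'', hh''⟩ := hR.proper r
  rcases hR.contact (G.adj_of_isOuter hF.isOuter_r hF.isOuter_b hF.ne_rb) with
    ⟨k, hk⟩ | ⟨k, hk⟩ <;> cases k
  · rw [mem_side_red (hR.proper b)] at hk; simp only [corner] at hk; linarith
  · exact Or.inl hk
  · have := (mem_region.1 (side_subset_region (hR.proper b) _ hk)).1
    simp only [corner] at this; linarith
  · exact Or.inr hk
  · rw [mem_side_blue (hR.proper r)] at hk; simp only [corner] at hk; linarith
  · have := (mem_region.1 (side_subset_region (hR.proper r) _ hk)).2.1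
    simp only [corner] at this; linarith

/-- No corner of an outer triangle touches an inner one. -/
theorem corner_notMem_region (hF : IsFrame G R r b g) (hR : IsRTRepresentation G R) {v x : V}
    (hv : G.IsOuter v) (hx : ¬ G.IsOuter x) (k : Color) :
    (R v).corner k ∉ (R x).region := by
  have hin : ∃ x, ¬ G.IsOuter x := ⟨x, hx⟩
  intro hk
  have l := left_le_of_mem (hR.proper x) hk
  have t := le_top_of_mem (hR.proper x) hk
  obtain ⟨c1, c2, c3⟩ := mem_region.1 hk
  obtain ⟨hw, hh⟩ := hR.proper x
  have hxr := hF.slack_green_red_neg hR hx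
  have hxb := hF.slack_green_blue_neg hR hx
  rcases (hF.isOuter_iff v).1 hv with rfl | rfl | rfl
  · obtain ⟨hw', hh'⟩ := hR.proper v
    have h1 := hF.left_red x hx
    have h2 := hF.right_red x hx
    have h3 := hF.bottom_red x hx
    cases k <;> simp only [corner] at l t c1 c2 c3
    · linarith
    · have := eq_of_slack_le (hR.proper x) (p := ((R v).left, (R v).bottom))
        (q := ((R x).right, (R x).top)) c1 h3 (by rwa [slack_red])
      simp only [Prod.mk.injEq] at this
      linarith
    -- The right corner of this outer triangle could only meet the top corner of `x`, whose slack
    -- with respect to `g` is negative. Either contact with `g` gives that point slack zero. The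
    -- right corner of `b` is treated likewise below.
    · have e1 : (R x).right = (R v).right := le_antisymm h2 c1
      have e2 : (R x).top = (R v).bottom := le_antisymm h3 t
      rw [e1, e2] at hxr
      rcases hF.contact_rg hR hin with hc | hc
      · rw [mem_side_green (hR.proper g)] at hc
        simp only [corner] at hc
        linarith
      · rw [mem_side_red (hR.proper v)] at hc
        simp only [corner] at hc
        have h5 := hF.right_green x hx
        have e3 : (R g).right = (R v).right := le_antisymm hc.2.2 (e1 ▸ h5)
        rw [← e3, ← hc.1, slack_red] at hxr
        exact lt_irrefl _ hxr
  · obtain ⟨hw', hh'⟩ := hR.proper v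
    have h1 := hF.right_blue x hx
    have h2 := hF.bottom_blue x hx
    have h3 := hF.top_blue x hx
    cases k <;> simp only [corner] at l t c1 c2 c3
    · have e1 : (R v).right = (R x).left := le_antisymm h1 l
      have e2 : (R v).top = (R x).bottom := by
        by_contra hne
        have := slack_strictMono_snd (hR.proper x) (p := ((R v).right, (R v).top))
          (q := ((R x).left, (R x).bottom)) e1.le (lt_of_le_of_ne c2 (Ne.symm hne))
        rw [slack_blue] at this
        linarith
      linarith
    · linarith
    · have e1 : (R v).right = (R x).left := le_antisymm h1 l
      have e2 : (R v).bottom = (R x).bottom := le_antisymm h2 c2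
      rw [← e1, ← e2] at hxb
      rcases hF.contact_bg hR hin with hc | hc
      · rw [mem_side_green (hR.proper g)] at hc
        simp only [corner] at hc
        linarith
      · rw [mem_side_blue (hR.proper v)] at hc
        simp only [corner] at hc
        have h5 := hF.bottom_green x hx
        have e3 : (R g).bottom = (R v).bottom := le_antisymm (e2 ▸ h5) hc.2.1
        rw [← hc.1, ← e3, slack_blue] at hxb
        exact lt_irrefl _ hxb
  · obtain ⟨hw', hh'⟩ := hR.proper v
    have h1 := hF.left_green x hx
    have h2 := hF.right_green x hx
    have h3 := hF.bottom_green x hx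
    have h4 := hF.top_green x hx
    have h5 := hF.slack_green x hx
    cases k <;> simp only [corner] at l t c1 c2 c3
    · rw [le_antisymm h2 c1, le_antisymm h4 t, slack_red] at hxr
      exact lt_irrefl _ hxr
    · rw [le_antisymm l h1, le_antisymm c2 h3, slack_blue] at hxb
      exact lt_irrefl _ hxb
    · have := slack_green_pos (hR.proper v)
      rw [le_antisymm h2 c1, le_antisymm c2 h3] at h5
      linarith

/-- A corner of an inner triangle touches the outer vertex of its colour only. -/
theorem color_of_corner_mem (hF : IsFrame G R r b g) (hR : IsRTRepresentation G R) {x : V}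
    (hx : ¬ G.IsOuter x) {k : Color} :
    ((R x).corner k ∈ (R r).side k → k = .red) ∧ ((R x).corner k ∈ (R b).side k → k = .blue) ∧
      ((R x).corner k ∈ (R g).side k → k = .green) := by
  have h1 := hF.right_red x hx
  have h2 := hF.bottom_red x hx
  have h3 := hF.right_blue x hx
  have h4 := hF.bottom_blue x hx
  have h5 := hF.left_green x hx
  have h6 := hF.right_green x hx
  have h7 := hF.bottom_green x hx
  obtain ⟨hw, hh⟩ := hR.proper x
  refine ⟨fun hk => ?_, fun hk => ?_, fun hk => ?_⟩
  · cases k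
    · rfl
    · rw [mem_side_blue (hR.proper r)] at hk; simp only [corner] at hk; linarith
    · have := (mem_region.1 (side_subset_region (hR.proper r) _ hk)).2.1
      simp only [corner] at this; linarith
  · cases k
    · rw [mem_side_red (hR.proper b)] at hk; simp only [corner] at hk; linarith
    · rfl
    · have := (mem_region.1 (side_subset_region (hR.proper b) _ hk)).1
      simp only [corner] at this; linarith
  · cases k
    · rw [mem_side_red (hR.proper g)] at hk; simp only [corner] at hk; linarith
    · rw [mem_side_blue (hR.proper g)] at hk; simp only [corner] at hk; linarith
    · rfl

end IsFrame

/-! ### Positions along the boundary of a triangle -/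

/-- The positions of triangles that touch the side opposite to the corner `k` with a corner. -/
def InPos (k : Color) (x : ℝ) : Prop := cornerPos k.succ + 1 ≤ x ∧ x ≤ cornerPos k.succ + 2

/-- The positions of triangles that have the corner `k` on the compatible side. -/
def OutPos (k : Color) (x : ℝ) : Prop :=
  x = cornerPos k ∨ x = cornerPos k + 1 ∨ x = cornerPos k.succ.succ + 2

/-- The circular order is out `k`, in `k.succ.succ`, out `k.succ`, in `k`, out `k.succ.succ`, in
`k.succ`. Neighbouring blocks overlap in end points of sides, hence the assumptions of distinct
positions. -/
theorem OutPos.cyclicBetween {k : Color} {x y z : ℝ} (hx : OutPos k x) (hy : OutPos k.succ y)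
    (hz : OutPos k.succ.succ z ∨ InPos k z ∨ InPos k.succ z) (hxz : x ≠ z) (hyz : y ≠ z) :
    CyclicBetween x y z := by
  cases k <;> simp only [OutPos, InPos, Color.succ, cornerPos] at hx hy hz <;>
    unfold CyclicBetween <;> grind (splits := 30)

theorem InPos.cyclicBetween {k : Color} {x y z : ℝ} (hx : InPos k x)
    (hy : OutPos k.succ.succ y)
    (hz : OutPos k z ∨ OutPos k.succ z ∨ InPos k.succ z ∨ InPos k.succ.succ z) (hxy : x ≠ y)
    (hxz : x ≠ z) (hyz : y ≠ z) : CyclicBetween x y z := by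
  cases k <;> simp only [OutPos, InPos, Color.succ, cornerPos] at hx hy hz <;>
    unfold CyclicBetween <;> grind (splits := 30)

namespace RightTriangle

variable {A B C : RightTriangle}

theorem hasPos_of_corner_mem_side {k : Color} (h : B.corner k ∈ A.side k) :
    ∃ s, A.HasPos B (cornerPos k.succ + 1 + s) ∧ 0 ≤ s ∧ s ≤ 1 ∧
      B.corner k = (1 - s) • A.corner k.succ + s • A.corner k.succ.succ := by
  rw [side, segment_eq_image] at h
  obtain ⟨s, hs, he⟩ := h
  exact ⟨s, Or.inl ⟨k, s, hs, he.symm, rfl⟩, hs.1, hs.2, he.symm⟩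

theorem exists_hasPos_inPos {k : Color} (h : B.corner k ∈ A.side k) :
    ∃ x, A.HasPos B x ∧ InPos k x := by
  obtain ⟨s, hs, h0, h1, -⟩ := hasPos_of_corner_mem_side h
  exact ⟨_, hs, by unfold InPos; constructor <;> linarith⟩

/-- If a corner of `B` coincides with the corner of `A`, `HasPos` counts `B` as met at an end of an
adjacent side. This is the source of the second and third value in `OutPos`. -/
theorem Separate.exists_hasPos_outPos (hs : Separate A B) {k : Color} (h : A.corner k ∈ B.side k) :
    ∃ x, A.HasPos B x ∧ OutPos k x := by
  by_cases hc : ∃ j, B.corner j ∈ A.side j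
  · obtain ⟨j, hj⟩ := hc
    have he : B.corner j = A.corner k := hs.eq_of_mem (side_subset_region hs.left _ hj)
      (corner_mem_region hs.right j) (corner_mem_region hs.left k)
      (side_subset_region hs.right _ h)
    rcases Color.eq_or j k with rfl | rfl | rfl
    · exact absurd he.symm (hs.corner_ne _)
    · refine ⟨_, Or.inl ⟨k.succ, 1, by simp, ?_, rfl⟩, ?_⟩
      · simpa [Color.succ_succ_succ] using he
      · right; right; ring
    · refine ⟨_, Or.inl ⟨k.succ.succ, 0, by simp, ?_, rfl⟩, ?_⟩
      · simpa [Color.succ_succ_succ] using he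
      · simp [OutPos, Color.succ_succ_succ]
  · push Not at hc
    exact ⟨_, Or.inr ⟨hc, k, h, rfl⟩, Or.inl rfl⟩

theorem cornerPos_add_injective {j k : Color} {s t : ℝ} (hs : s ∈ Set.Icc (0 : ℝ) 1)
    (ht : t ∈ Set.Icc (0 : ℝ) 1) (h : cornerPos j + s = cornerPos k + t) : j = k := by
  obtain ⟨h1, h2⟩ := hs
  obtain ⟨h3, h4⟩ := ht
  cases j <;> cases k <;> simp only [cornerPos] at h <;> first | rfl | (exfalso; linarith)

/-- On a side, equal positions would mean coinciding corners of one colour. At a corner of `A`, two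
compatible sides through that point would make it a corner of `B`, and `B` would count as met on a
side. -/
theorem HasPos.ne (hBC : Separate B C) {x y : ℝ} (hx : A.HasPos B x)
    (hy : A.HasPos C y) : x ≠ y := by
  rintro rfl
  rcases hx with ⟨k, s, hs, he, hx⟩ | ⟨hno, k, hk, hx⟩ <;>
    rcases hy with ⟨j, t, ht, he', hy⟩ | ⟨hno', j, hj, hy⟩
  · have hjk := cornerPos_add_injective hs ht (j := k.succ) (k := j.succ) (by linarith)
    have : k = j := by cases k <;> cases j <;> simp [Color.succ] at hjk ⊢
    subst this
    have : s = t := by linarith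
    subst this
    exact hBC.corner_ne k (he.trans he'.symm)
  · obtain ⟨h1, h2⟩ := hs
    cases k <;> cases j <;> simp only [cornerPos, Color.succ] at hx hy <;> linarith
  · obtain ⟨h1, h2⟩ := ht
    cases k <;> cases j <;> simp only [cornerPos, Color.succ] at hx hy <;> linarith
  · have : k = j := cornerPos_add_injective (s := 0) (t := 0) (by simp) (by simp) (by linarith)
    subst this
    rcases hBC.corners_of_mem_side hk hj with ⟨h1, -⟩ | ⟨h1, -⟩
    · exact hno _ (h1 ▸ A.corner_mem_side_succ k)
    · exact hno _ (h1 ▸ A.corner_mem_side_succ_succ k)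

end RightTriangle

/-! ### Systems of arcs -/

/-- Every inner edge is oriented as one of its contacts of a corner with a compatible side, so that
each corner of an inner triangle is used once. -/
structure IsArcSystem (G : PlaneTriangulation V) (R : V → RightTriangle)
    (a : Color → V → V → Prop) : Prop where
  inner : ∀ k u v, a k u v → ¬ G.IsOuter u
  ne : ∀ k u v, a k u v → u ≠ v
  mem_side : ∀ k u v, a k u v → (R u).corner k ∈ (R v).side k
  total : ∀ u v, G.IsInnerEdge u v → (∃ k, a k u v) ∨ (∃ k, a k v u)
  asymm : ∀ j k u v, a j u v → ¬ a k v u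
  out : ∀ v, ¬ G.IsOuter v → ∀ k, ∃! u, a k v u

namespace IsArcSystem

variable {a : Color → V → V → Prop}

theorem adj (ha : IsArcSystem G R a) (hR : IsRTRepresentation G R) {k : Color} {u v : V}
    (h : a k u v) : G.graph.Adj u v :=
  hR.adj_of_corner_mem (ha.ne k u v h) (side_subset_region (hR.proper v) _ (ha.mem_side k u v h))

theorem exists_outPos (ha : IsArcSystem G R a) (hR : IsRTRepresentation G R) {k : Color} {u v : V}
    (h : a k u v) : ∃ x, (R u).HasPos (R v) x ∧ OutPos k x :=
  (hR.separate (ha.ne k u v h)).exists_hasPos_outPos (ha.mem_side k u v h)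

theorem exists_inPos (ha : IsArcSystem G R a) {k : Color} {u v : V}
    (h : a k u v) : ∃ x, (R v).HasPos (R u) x ∧ InPos k x :=
  exists_hasPos_inPos (ha.mem_side k u v h)

/-- Otherwise the successor `w` lies beyond the target `o` of the arc of colour `k.succ`, and `o`
would be passed strictly between `u` and `w`, against `rotation`. For `after_in` the barrier is the
arc of colour `k.succ.succ`. -/
theorem after_out (ha : IsArcSystem G R a) (hR : IsRTRepresentation G R) {v : V}
    (hv : ¬ G.IsOuter v) (k : Color) (u : V) (h : a k v u) :
    a k.succ.succ (G.next v u) v ∨ a k.succ v (G.next v u) := by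
  have hadj := ha.adj hR h
  have hadj' := G.adj_next v u hadj
  obtain ⟨o, ho, -⟩ := ha.out v hv k.succ
  obtain ⟨x, hx, hx'⟩ := ha.exists_outPos hR h
  obtain ⟨y, hy, hy'⟩ := ha.exists_outPos hR ho
  have huw : u ≠ G.next v u := (G.face_triangle v u hadj).1.ne
  have hrot := hR.rotation v u o hadj (ha.adj hR ho) x y
  generalize G.next v u = w at *
  by_contra! hc
  obtain ⟨hc1, hc2⟩ := hc
  have how : o ≠ w := by rintro rfl; exact hc2 ho
  have key : ∃ z, (R v).HasPos (R w) z ∧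
      (OutPos k.succ.succ z ∨ InPos k z ∨ InPos k.succ z) := by
    rcases ha.total v w ⟨hadj', fun h => hv h.1⟩ with ⟨j, hj⟩ | ⟨j, hj⟩
    · rcases Color.eq_or j k with rfl | rfl | rfl
      · exact absurd ((ha.out v hv j).unique h hj) huw
      · exact absurd hj hc2
      · obtain ⟨z, hz, hz'⟩ := ha.exists_outPos hR hj
        exact ⟨z, hz, Or.inl hz'⟩
    · obtain ⟨z, hz, hz'⟩ := ha.exists_inPos hj
      rcases Color.eq_or j k with rfl | rfl | rfl
      · exact ⟨z, hz, Or.inr (Or.inl hz')⟩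
      · exact ⟨z, hz, Or.inr (Or.inr hz')⟩
      · exact absurd hj hc1
  obtain ⟨z, hz, hz'⟩ := key
  exact hrot z hx hy hz (hx'.cyclicBetween hy' hz' (hx.ne (hR.separate huw) hz)
    (hy.ne (hR.separate how) hz))

theorem after_in (ha : IsArcSystem G R a) (hR : IsRTRepresentation G R) {v : V}
    (hv : ¬ G.IsOuter v) (k : Color) (u : V) (h : a k u v) :
    a k (G.next v u) v ∨ a k.succ.succ v (G.next v u) := by
  have hadj := (ha.adj hR h).symm
  have hadj' := G.adj_next v u hadj
  obtain ⟨o, ho, -⟩ := ha.out v hv k.succ.succ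
  obtain ⟨x, hx, hx'⟩ := ha.exists_inPos h
  obtain ⟨y, hy, hy'⟩ := ha.exists_outPos hR ho
  have huw : u ≠ G.next v u := (G.face_triangle v u hadj).1.ne
  have huo : u ≠ o := by rintro rfl; exact ha.asymm _ _ _ _ h ho
  have hrot := hR.rotation v u o hadj (ha.adj hR ho) x y
  generalize G.next v u = w at *
  by_contra! hc
  obtain ⟨hc1, hc2⟩ := hc
  have how : o ≠ w := by rintro rfl; exact hc2 ho
  have key : ∃ z, (R v).HasPos (R w) z ∧
      (OutPos k z ∨ OutPos k.succ z ∨ InPos k.succ z ∨ InPos k.succ.succ z) := by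
    rcases ha.total v w ⟨hadj', fun h => hv h.1⟩ with ⟨j, hj⟩ | ⟨j, hj⟩
    · obtain ⟨z, hz, hz'⟩ := ha.exists_outPos hR hj
      rcases Color.eq_or k j with rfl | rfl | rfl
      · exact ⟨z, hz, Or.inl hz'⟩
      · exact absurd (by rwa [Color.succ_succ_succ]) hc2
      · exact ⟨z, hz, Or.inr (Or.inl (by rwa [Color.succ_succ_succ]))⟩
    · obtain ⟨z, hz, hz'⟩ := ha.exists_inPos hj
      rcases Color.eq_or k j with rfl | rfl | rfl
      · exact absurd hj hc1
      · exact ⟨z, hz, Or.inr (Or.inr (Or.inr (by rwa [Color.succ_succ_succ])))⟩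
      · exact ⟨z, hz, Or.inr (Or.inr (Or.inl (by rwa [Color.succ_succ_succ])))⟩
  obtain ⟨z, hz, hz'⟩ := key
  exact hrot z hx hy hz (hx'.cyclicBetween hy' hz' (hx.ne (hR.separate huo) hy)
    (hx.ne (hR.separate huw) hz) (hy.ne (hR.separate how) hz))

end IsArcSystem

/-! ### The outer face -/

namespace PlaneTriangulation

theorem IsOuterFace.next_eq {u v w : V} (h : G.IsOuterFace u v w) : G.next u v = w := by
  have h1 := (G.face_triangle _ _ G.outer_adj).2
  have h2 := (G.face_triangle _ _ G.adj_outer₂₃)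
  rw [G.outer_next] at h1
  rcases h with ⟨rfl, rfl, rfl⟩ | ⟨rfl, rfl, rfl⟩ | ⟨rfl, rfl, rfl⟩
  · exact G.outer_next
  · exact h1
  · rw [h1] at h2; exact h2.2

theorem isOuterFace_or {r b g : V} (h : ∀ v, G.IsOuter v ↔ v = r ∨ v = b ∨ v = g)
    (hrb : r ≠ b) (hrg : r ≠ g) (hbg : b ≠ g) : G.IsOuterFace r g b ∨ G.IsOuterFace r b g := by
  have h1 := (h r).2 (by simp)
  have h2 := (h b).2 (by simp)
  have h3 := (h g).2 (by simp)
  unfold IsOuter at h1 h2 h3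
  unfold IsOuterFace
  grind

end PlaneTriangulation

/-- Some inner top corner lies on the horizontal side of `r`. Counterclockwise around `r` it is met
between `b` and `g`, so `g` cannot directly follow `b`. -/
theorem IsFrame.isOuterFace {r b g : V} {a : Color → V → V → Prop} (hF : IsFrame G R r b g)
    (hR : IsRTRepresentation G R) (ha : IsArcSystem G R a) (hin : ∃ x, ¬ G.IsOuter x) :
    G.IsOuterFace r g b := by
  refine (PlaneTriangulation.isOuterFace_or hF.isOuter_iff hF.ne_rb hF.ne_rg
    hF.ne_bg).resolve_right fun hface => ?_
  have hnext := hface.next_eq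
  -- The red arc of an inner vertex leads to a triangle with a higher horizontal side, so from the
  -- highest inner vertex it leads to an outer one.
  obtain ⟨w, hw, hmax⟩ : ∃ w, ¬ G.IsOuter w ∧ ∀ x, ¬ G.IsOuter x →
      (R x).bottom ≤ (R w).bottom := by
    obtain ⟨w, hw, hmax⟩ := Set.exists_max_image {x | ¬ G.IsOuter x} (fun x => (R x).bottom)
      (Set.toFinite _) hin
    exact ⟨w, hw, hmax⟩
  obtain ⟨u, hu, -⟩ := ha.out w hw .red
  have hus := ha.mem_side _ _ _ hu
  have huo : G.IsOuter u := by
    by_contra hu'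
    have h1 := hmax u hu'
    have h2 := ((mem_side_red (hR.proper u)).1 hus).1
    simp only [corner] at h2
    linarith [(hR.proper w).2]
  obtain ⟨c1, c2, c3⟩ := hF.color_of_corner_mem hR hw (k := .red)
  have hur : u = r := by
    rcases (hF.isOuter_iff u).1 huo with rfl | rfl | rfl
    · rfl
    · cases c2 hus
    · cases c3 hus
  subst hur
  obtain ⟨s, hs, hs0, hs1, hse⟩ := hasPos_of_corner_mem_side hus
  simp only [corner, Color.succ, Prod.smul_mk, smul_eq_mul, Prod.mk_add_mk, Prod.mk.injEq] at hse
  have hbw : b ≠ w := by rintro rfl; exact hw hF.isOuter_b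
  have hwg : w ≠ g := by rintro rfl; exact hw hF.isOuter_g
  have hwid := (hR.proper u).1
  have key1 : ∃ x, (R u).HasPos (R b) x ∧ x < cornerPos Color.red.succ + 1 + s := by
    rcases hF.contact_rb hR hin with hc | hc
    · obtain ⟨x, hx, hx'⟩ := (hR.separate hF.ne_rb).exists_hasPos_outPos hc
      refine ⟨x, hx, lt_of_le_of_ne ?_ (hx.ne (hR.separate hbw) hs)⟩
      rcases hx' with rfl | rfl | rfl <;> simp only [cornerPos, Color.succ] <;> linarith
    · obtain ⟨t, ht, ht0, ht1, hte⟩ := hasPos_of_corner_mem_side hc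
      refine ⟨_, ht, lt_of_le_of_ne ?_ (ht.ne (hR.separate hbw) hs)⟩
      simp only [corner, Color.succ, Prod.smul_mk, smul_eq_mul, Prod.mk_add_mk,
        Prod.mk.injEq] at hte
      have h1 := hF.right_blue w hw
      have h2 := (hR.proper w).1
      by_contra! hlt
      have hst : s < t := by linarith
      nlinarith [mul_pos (sub_pos.2 hst) (sub_pos.2 hwid)]
  have key2 : ∃ z, (R u).HasPos (R g) z ∧ cornerPos Color.red.succ + 1 + s < z := by
    rcases hF.contact_rg hR hin with hc | hc
    · obtain ⟨z, hz, hz'⟩ := (hR.separate hF.ne_rg).exists_hasPos_outPos hc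
      refine ⟨z, hz, lt_of_le_of_ne ?_ (hs.ne (hR.separate hwg) hz)⟩
      rcases hz' with rfl | rfl | rfl <;> simp only [cornerPos, Color.succ] <;> linarith
    · obtain ⟨t, ht, ht0, ht1, hte⟩ := hasPos_of_corner_mem_side hc
      refine ⟨_, ht, lt_of_le_of_ne ?_ (hs.ne (hR.separate hwg) ht)⟩
      simp only [corner, Color.succ, Prod.smul_mk, smul_eq_mul, Prod.mk_add_mk,
        Prod.mk.injEq] at hte
      have h1 := hF.right_green w hw
      by_contra! hlt
      have hst : t < s := by linarith
      nlinarith [mul_pos (sub_pos.2 hst) (sub_pos.2 hwid)]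
  obtain ⟨x, hx, hx'⟩ := key1
  obtain ⟨z, hz, hz'⟩ := key2
  exact hR.rotation u b w (G.adj_of_isOuter hF.isOuter_r hF.isOuter_b hF.ne_rb)
    (ha.adj hR hu).symm x _ z hx hs (hnext.symm ▸ hz) (Or.inl ⟨hx', hz'⟩)

/-- An arc system is a Schnyder wood. -/
def IsArcSystem.toSchnyderWood {a : Color → V → V → Prop} (ha : IsArcSystem G R a)
    (hR : IsRTRepresentation G R) (hin : ∃ x, ¬ G.IsOuter x) : SchnyderWood G where
  arc := a
  arc_inner k u v h := ⟨ha.adj hR h, fun ho => ha.inner k u v h ho.1⟩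
  arc_exists := ha.total
  arc_asymm := ha.asymm
  arc_color j k u v hj hk := by
    have hne := hR.separate (ha.ne j u v hj)
    have h1 := ha.mem_side j u v hj
    have h2 := ha.mem_side k u v hk
    exact corner_injective (hR.proper u) (hne.eq_of_mem (corner_mem_region hne.left j)
      (side_subset_region hne.right _ h1) (corner_mem_region hne.left k)
      (side_subset_region hne.right _ h2))
  out_inner := ha.out
  out_outer v hv k u h := ha.inner k v u h hv
  after_out _ hv := ha.after_out hR hv
  after_in _ hv := ha.after_in hR hv
  outer_color := by
    obtain ⟨r, b, g, hF⟩ := hR.exists_frame hin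
    refine ⟨fun k => match k with | .red => r | .blue => b | .green => g,
      hF.isOuterFace hR ha hin, fun j k u h => ?_⟩
    have h1 := ha.mem_side _ _ _ h
    obtain ⟨c1, c2, c3⟩ := hF.color_of_corner_mem hR (ha.inner _ _ _ h) (k := j)
    cases k
    · exact c1 h1
    · exact c2 h1
    · exact c3 h1

theorem SchnyderWood.isArcSystem {T : SchnyderWood G} (hT : Corresponds R T) :
    IsArcSystem G R T.arc where
  inner k u v h ho := T.out_outer u ho k v h
  ne k u v h := (T.arc_inner k u v h).1.ne
  mem_side := hT
  total := T.arc_exists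
  asymm := T.arc_asymm
  out := T.out_inner

/-! ### Counting inner edges and corners of inner triangles -/

def Color.equivFin : Color ≃ Fin 3 where
  toFun | .red => 0 | .blue => 1 | .green => 2
  invFun | 0 => .red | 1 => .blue | 2 => .green
  left_inv k := by cases k <;> rfl
  right_inv i := by fin_cases i <;> rfl

instance : Finite Color := Finite.of_equiv _ Color.equivFin.symm

namespace PlaneTriangulation

theorem ncard_isOuter (G : PlaneTriangulation V) : {v | G.IsOuter v}.ncard = 3 :=
  Set.ncard_eq_three.2 ⟨_, _, _, G.outer_adj.ne, G.adj_outer₁₃.ne, G.adj_outer₂₃.ne, rfl⟩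

/-- The inner edges as unordered pairs. -/
def innerEdges (G : PlaneTriangulation V) : Set (Sym2 V) :=
  G.graph.edgeSet \ {s(G.outer₁, G.outer₂), s(G.outer₁, G.outer₃), s(G.outer₂, G.outer₃)}

theorem mk_mem_innerEdges {u v : V} : s(u, v) ∈ G.innerEdges ↔ G.IsInnerEdge u v := by
  have h1 := G.outer_adj.ne
  have h2 := G.adj_outer₁₃.ne
  have h3 := G.adj_outer₂₃.ne
  have h4 : ∀ x y, G.graph.Adj x y → x ≠ y := fun _ _ h => h.ne
  simp only [innerEdges, Set.mem_sdiff, SimpleGraph.mem_edgeSet, Set.mem_insert_iff,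
    Set.mem_singleton_iff, Sym2.eq_iff, IsInnerEdge, IsOuter]
  grind

theorem ncard_innerEdges (G : PlaneTriangulation V) :
    G.innerEdges.ncard + 3 = G.graph.edgeSet.ncard := by
  have h1 := G.outer_adj.ne
  have h2 := G.adj_outer₁₃.ne
  have h3 := G.adj_outer₂₃.ne
  have hcard : ({s(G.outer₁, G.outer₂), s(G.outer₁, G.outer₃), s(G.outer₂, G.outer₃)} :
      Set (Sym2 V)).ncard = 3 := by
    refine Set.ncard_eq_three.2 ⟨_, _, _, ?_, ?_, ?_, rfl⟩ <;>
      simp only [ne_eq, Sym2.eq_iff] <;> grind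
  have := Set.ncard_sdiff_add_ncard_of_subset (s := {s(G.outer₁, G.outer₂), s(G.outer₁, G.outer₃),
    s(G.outer₂, G.outer₃)}) (t := G.graph.edgeSet) (by
      rintro e (rfl | rfl | rfl)
      · exact G.outer_adj
      · exact G.adj_outer₁₃
      · exact G.adj_outer₂₃)
  rwa [hcard] at this

/-- By Euler's formula both numbers equal 3(n - 3). This direction makes an injection from inner
edges to corners bijective. -/
theorem card_corners_le (G : PlaneTriangulation V) :
    Nat.card ({v // ¬ G.IsOuter v} × Color) ≤ Nat.card G.innerEdges := by
  have h1 := Set.ncard_add_ncard_compl {v | G.IsOuter v}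
  have h2 := G.ncard_isOuter
  have h3 := G.ncard_innerEdges
  have h4 := G.euler
  have h5 : Nat.card {v // ¬ G.IsOuter v} = {v | G.IsOuter v}ᶜ.ncard := rfl
  have h6 : Nat.card G.innerEdges = G.innerEdges.ncard := rfl
  rw [Nat.card_prod, Nat.card_congr Color.equivFin, Nat.card_fin, h5, h6]
  rw [Nat.card_eq_fintype_card] at h1
  omega

end PlaneTriangulation

/-- The arcs of the contacts of a corner with a compatible side, where three triangles with a
common corner point are oriented from the red to the blue to the green corner. -/
def CyclicArc (G : PlaneTriangulation V) (R : V → RightTriangle) (k : Color) (u v : V) : Prop :=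
  ¬ G.IsOuter u ∧ u ≠ v ∧ (R u).corner k ∈ (R v).side k ∧
    (R v).corner k.succ.succ ≠ (R u).corner k

/-- If a corner lies on the compatible sides of two triangles, one of these has its corner
`k.succ.succ` there, which `CyclicArc` forbids. -/
theorem CyclicArc.right_unique (hR : IsRTRepresentation G R) {k : Color} {u v w : V}
    (hv : CyclicArc G R k u v) (hw : CyclicArc G R k u w) : v = w := by
  by_contra hne
  rcases (hR.separate hne).corners_of_mem_side hv.2.2.1 hw.2.2.1 with h | h
  · exact hw.2.2.2 h.2
  · exact hv.2.2.2 h.1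

theorem CyclicArc.asymm (hR : IsRTRepresentation G R) {j k : Color} {u v : V}
    (hu : CyclicArc G R j u v) (hv : CyclicArc G R k v u) : False := by
  have hs := hR.separate hu.2.1
  have he : (R u).corner j = (R v).corner k :=
    hs.eq_of_mem (corner_mem_region hs.left j) (side_subset_region hs.right _ hu.2.2.1)
      (side_subset_region hs.left _ hv.2.2.1) (corner_mem_region hs.right k)
  rcases Color.eq_or j k with rfl | rfl | rfl
  · exact hs.corner_ne _ he
  · exact hu.2.2.2 (by rw [Color.succ_succ_succ, he])
  · exact hv.2.2.2 he

theorem CyclicArc.total (hR : IsRTRepresentation G R) {u v : V} (h : G.IsInnerEdge u v) :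
    (∃ k, CyclicArc G R k u v) ∨ (∃ k, CyclicArc G R k v u) := by
  wlog hc : ∃ k, (R u).corner k ∈ (R v).side k generalizing u v
  · exact (this ⟨h.1.symm, fun ho => h.2 ho.symm⟩ ((hR.contact h.1).resolve_left hc)).symm
  obtain ⟨k, hk⟩ := hc
  have hin : ∃ x, ¬ G.IsOuter x := by
    by_contra! hc
    exact h.2 ⟨hc u, hc v⟩
  obtain ⟨r, b, g, hF⟩ := hR.exists_frame hin
  have hu : ¬ G.IsOuter u := fun ho =>
    hF.corner_notMem_region hR ho (fun hv => h.2 ⟨ho, hv⟩) k (side_subset_region (hR.proper v) _ hk)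
  -- When the contact from `u` to `v` is the forbidden one, the coinciding corners also give a
  -- contact from `v` to `u`, and that one is allowed.
  by_cases hd : (R v).corner k.succ.succ = (R u).corner k
  · have hv : ¬ G.IsOuter v := fun ho =>
      hF.corner_notMem_region hR ho hu k.succ.succ (hd ▸ corner_mem_region (hR.proper u) k)
    refine Or.inr ⟨k.succ.succ, hv, h.1.ne', hd ▸ (R u).corner_mem_side_succ_succ k, fun he => ?_⟩
    rw [hd, Color.succ_succ_succ] at he
    exact Color.succ_ne k (corner_injective (hR.proper u) he)
  · exact Or.inl ⟨k, hu, h.1.ne, hk, hd⟩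

/-- Assigning to each inner edge the corner that realizes it is injective by
`CyclicArc.right_unique`. By counting it is surjective, so every corner of an inner triangle has an
arc. -/
theorem isArcSystem_cyclicArc (hR : IsRTRepresentation G R) :
    IsArcSystem G R (CyclicArc G R) where
  inner k u v h := h.1
  ne k u v h := h.2.1
  mem_side k u v h := h.2.2.1
  total u v h := CyclicArc.total hR h
  asymm j k u v h h' := h.asymm hR h'
  out v hv k := by
    have hex : ∀ e : G.innerEdges, ∃ c : {v // ¬ G.IsOuter v} × Color, ∃ w,
        e.1 = s(c.1.1, w) ∧ CyclicArc G R c.2 c.1.1 w := by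
      rintro ⟨e, he⟩
      induction e using Sym2.ind with | _ x y
      rcases CyclicArc.total hR (PlaneTriangulation.mk_mem_innerEdges.1 he) with ⟨j, hj⟩ | ⟨j, hj⟩
      · exact ⟨(⟨x, hj.1⟩, j), y, rfl, hj⟩
      · exact ⟨(⟨y, hj.1⟩, j), x, Sym2.eq_swap, hj⟩
    choose f w hf hw using hex
    have hinj : Function.Injective f := by
      intro e e' h
      have h1 := hw e
      have h2 := hw e'
      have h3 := hf e
      have h4 := hf e'
      rw [h] at h1 h3
      rw [h1.right_unique hR h2] at h3
      exact Subtype.ext (h3.trans h4.symm)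
    obtain ⟨e, he⟩ := (hinj.bijective_of_nat_card_le G.card_corners_le).surjective (⟨v, hv⟩, k)
    have := hw e
    rw [he] at this
    exact ⟨w e, this, fun y hy => hy.right_unique hR this⟩

/-! ### Flips -/

theorem FacialFlip.symm {T T' : SchnyderWood G} (h : FacialFlip T T') : FacialFlip T' T := by
  obtain ⟨a, b, c, i, j, k, hf, ⟨h1, h2, h3⟩, ⟨h4, h5, h6⟩, h⟩ := h
  refine ⟨a, c, b, i, k, j, hf.symm, ⟨h4, h6, h5⟩, ⟨h1, h3, h2⟩, fun m u v hn => (h m u v ?_).symm⟩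
  rintro ⟨hu, hv⟩
  exact hn ⟨hu.imp_right Or.symm, hv.imp_right Or.symm⟩

theorem ObtainedByFacialFlips.symm {T T' : SchnyderWood G} (h : ObtainedByFacialFlips T T') :
    ObtainedByFacialFlips T' T := by
  induction h with
  | refl => exact Relation.ReflTransGen.refl
  | tail _ h ih => exact Relation.ReflTransGen.head h.symm ih

/-- Two systems of arcs can be combined along a set `S` whose vertices use the same corners within
`S` in both systems. -/
theorem IsArcSystem.piecewise {a c : Color → V → V → Prop} (ha : IsArcSystem G R a)
    (hc : IsArcSystem G R c) (S : Set V)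
    (hS : ∀ x ∈ S, ∃ i, (∃ y ∈ S, a i x y) ∧ (∃ y ∈ S, c i x y) ∧
      ∀ m, ∀ y ∈ S, a m x y ∨ c m x y → m = i) :
    IsArcSystem G R (fun m x y => ((x ∈ S ∧ y ∈ S) ∧ c m x y) ∨ (¬ (x ∈ S ∧ y ∈ S) ∧ a m x y)) where
  inner k u v h := h.elim (fun h => hc.inner k u v h.2) (fun h => ha.inner k u v h.2)
  ne k u v h := h.elim (fun h => hc.ne k u v h.2) (fun h => ha.ne k u v h.2)
  mem_side k u v h := h.elim (fun h => hc.mem_side k u v h.2) (fun h => ha.mem_side k u v h.2)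
  total u v h := by
    have h1 := ha.total u v h
    have h2 := hc.total u v h
    by_cases hu : u ∈ S <;> by_cases hv : v ∈ S <;> simp only [hu, hv, true_and, and_true,
      and_self, not_true, not_false_iff, false_and, and_false, or_false, false_or, h1, h2]
  asymm j k u v h h' := by
    rcases h with ⟨hs, h⟩ | ⟨hs, h⟩ <;> rcases h' with ⟨hs', h'⟩ | ⟨hs', h'⟩
    · exact hc.asymm _ _ _ _ h h'
    · exact hs' hs.symm
    · exact hs hs'.symm
    · exact ha.asymm _ _ _ _ h h'
  out x hx m := by
    by_cases hxS : x ∈ S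
    · obtain ⟨i, ⟨y, hyS, hy⟩, ⟨z, hzS, hz⟩, hi⟩ := hS x hxS
      by_cases hm : m = i
      · subst hm
        refine ⟨z, Or.inl ⟨⟨hxS, hzS⟩, hz⟩, ?_⟩
        rintro w (⟨-, hw⟩ | ⟨hs, hw⟩)
        · exact (hc.out x hx m).unique hw hz
        · exact absurd ⟨hxS, (ha.out x hx m).unique hw hy ▸ hyS⟩ hs
      · obtain ⟨w, hw, hu⟩ := ha.out x hx m
        refine ⟨w, Or.inr ⟨fun hs => hm (hi m w hs.2 (Or.inl hw)), hw⟩, ?_⟩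
        rintro w' (⟨hs, hw'⟩ | ⟨hs, hw'⟩)
        · exact absurd (hi m w' hs.2 (Or.inr hw')) hm
        · exact hu w' hw'
    · simpa [hxS] using ha.out x hx m

/-- Three triangles whose corners of different colours are the same point. -/
structure IsCornerTriple (R : V → RightTriangle) (k : Color) (u v w : V) : Prop where
  ne_uv : u ≠ v
  ne_uw : u ≠ w
  ne_vw : v ≠ w
  corner_v : (R v).corner k.succ.succ = (R u).corner k
  corner_w : (R w).corner k.succ = (R u).corner k

namespace IsCornerTriple

variable {k : Color} {u v w : V}

theorem rotate {V : Type*} {R : V → RightTriangle} {k : Color} {u v w : V}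
    (h : IsCornerTriple R k u v w) : IsCornerTriple R k.succ w u v where
  ne_uv := h.ne_uw.symm
  ne_uw := h.ne_vw.symm
  ne_vw := h.ne_uv
  corner_v := by rw [Color.succ_succ_succ, h.corner_w]
  corner_w := by rw [h.corner_v, h.corner_w]

/-- No further triangle touches the common corner point. -/
theorem eq_or_eq (h : IsCornerTriple R k u v w) (hR : IsRTRepresentation G R) {z : V}
    (hz : (R u).corner k ∈ (R z).side k) : z = v ∨ z = w := by
  by_contra! hne
  have hw : (R u).corner k ∈ (R w).side k := h.corner_w ▸ (R w).corner_mem_side (Color.succ_ne k)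
  rcases (hR.separate hne.2).corners_of_mem_side hz hw with ⟨h1, h2⟩ | ⟨h1, h2⟩
  · have := corner_injective (hR.proper w) (h2.trans h.corner_w.symm)
    exact Color.succ_ne _ this
  · exact (hR.separate hne.1).corner_ne _ (h1.trans h.corner_v.symm)

/-- Around `u`, the triangles `w` and `v` are met just before and just after the corner `k`. A
neighbour between them would have to touch that corner, which `eq_or_eq` excludes; a successor of
`w` elsewhere would leave `v` strictly between. -/
theorem isFace (h : IsCornerTriple R k u v w) (hR : IsRTRepresentation G R) :
    G.IsFace u w v := by
  have hv : (R v).corner k.succ.succ ∈ (R u).side k.succ.succ :=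
    h.corner_v ▸ (R u).corner_mem_side_succ_succ k
  have hw : (R w).corner k.succ ∈ (R u).side k.succ :=
    h.corner_w ▸ (R u).corner_mem_side_succ k
  have hadjv := (hR.adj_of_corner_mem h.ne_uv.symm (side_subset_region (hR.proper u) _ hv)).symm
  have hadjw := (hR.adj_of_corner_mem h.ne_uw.symm (side_subset_region (hR.proper u) _ hw)).symm
  refine ⟨hadjw, ?_⟩
  have hposv : (R u).HasPos (R v) (cornerPos k + 1) := by
    refine Or.inl ⟨k.succ.succ, 0, by simp, ?_, by rw [Color.succ_succ_succ, add_zero]⟩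
    rw [h.corner_v, Color.succ_succ_succ]
    simp
  have hposw : (R u).HasPos (R w) (cornerPos k.succ.succ + 2) := by
    refine Or.inl ⟨k.succ, 1, by simp, ?_, by ring⟩
    rw [h.corner_w, Color.succ_succ_succ]
    simp
  have hadjz := G.adj_next u w hadjw
  have hwz : w ≠ G.next u w := (G.face_triangle u w hadjw).1.ne
  have hrot := hR.rotation u w v hadjw hadjv (cornerPos k.succ.succ + 2) (cornerPos k + 1)
  generalize G.next u w = z at *
  by_contra hzv
  have key : ∃ x, (R u).HasPos (R z) x ∧ (OutPos k.succ x ∨ OutPos k.succ.succ x ∨ InPos k x ∨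
      InPos k.succ x ∨ InPos k.succ.succ x) := by
    rcases hR.contact hadjz with ⟨j, hj⟩ | ⟨j, hj⟩
    · obtain ⟨x, hx, hx'⟩ := (hR.separate hadjz.ne).exists_hasPos_outPos hj
      rcases Color.eq_or j k with rfl | rfl | rfl
      · rcases h.eq_or_eq hR hj with rfl | rfl
        · exact absurd rfl hzv
        · exact absurd rfl hwz
      · exact ⟨x, hx, Or.inl hx'⟩
      · exact ⟨x, hx, Or.inr (Or.inl hx')⟩
    · obtain ⟨x, hx, hx'⟩ := exists_hasPos_inPos hj
      rcases Color.eq_or j k with rfl | rfl | rfl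
      · exact ⟨x, hx, by simp [hx']⟩
      · exact ⟨x, hx, by simp [hx']⟩
      · exact ⟨x, hx, by simp [hx']⟩
  obtain ⟨x, hx, hx'⟩ := key
  have n1 := hposw.ne (hR.separate hwz) hx
  have n2 := hposv.ne (hR.separate (Ne.symm hzv)) hx
  refine hrot x hposw hposv hx ?_
  clear hrot hx hposv hposw
  cases k <;> simp only [OutPos, InPos, Color.succ, cornerPos] at hx' n1 n2 ⊢ <;>
    unfold CyclicBetween <;> grind (splits := 30)

theorem arc_eq_color (h : IsCornerTriple R k u v w) (hR : IsRTRepresentation G R) {m : Color}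
    {y : V} (hy : y = v ∨ y = w) (hm : (R u).corner m ∈ (R y).side m) : m = k := by
  have huy : u ≠ y := by
    rcases hy with rfl | rfl
    · exact h.ne_uv
    · exact h.ne_uw
  have hmem : (R u).corner k ∈ (R y).region := by
    rcases hy with rfl | rfl
    · exact h.corner_v ▸ corner_mem_region (hR.proper y) _
    · exact h.corner_w ▸ corner_mem_region (hR.proper y) _
  exact corner_injective (hR.proper u) ((hR.separate huy).eq_of_mem
    (corner_mem_region (hR.proper u) m) (side_subset_region (hR.proper y) _ hm)
    (corner_mem_region (hR.proper u) k) hmem)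

theorem cyclicArc (h : IsCornerTriple R k u v w) (hR : IsRTRepresentation G R)
    (hu : ¬ G.IsOuter u) : CyclicArc G R k u w :=
  ⟨hu, h.ne_uw, h.corner_w ▸ (R w).corner_mem_side (Color.succ_ne k), fun he =>
    Color.succ_ne _ (corner_injective (hR.proper w) (he.trans h.corner_w.symm))⟩

/-- A system of arcs orients the three contacts as a directed triangle. -/
theorem arc_rotate (h : IsCornerTriple R k u v w) (hR : IsRTRepresentation G R)
    {a : Color → V → V → Prop} (ha : IsArcSystem G R a) (hw : ¬ G.IsOuter w) (huv : a k u v)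
    (hvw : ∃ j, a j v w) : a k.succ w u := by
  obtain ⟨z, hz, -⟩ := ha.out w hw k.succ
  obtain ⟨j, hj⟩ := hvw
  rcases h.rotate.eq_or_eq hR (ha.mem_side _ _ _ hz) with rfl | rfl
  · exact hz
  · exact absurd hz (ha.asymm _ _ _ _ hj)

theorem arc_vw (h : IsCornerTriple R k u v w) (hR : IsRTRepresentation G R)
    {a : Color → V → V → Prop} (ha : IsArcSystem G R a) (hv : ¬ G.IsOuter v) (huv : a k u v) :
    a k.succ.succ v w := by
  obtain ⟨z, hz, -⟩ := ha.out v hv k.succ.succ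
  rcases h.rotate.rotate.eq_or_eq hR (ha.mem_side _ _ _ hz) with rfl | rfl
  · exact hz
  · exact absurd hz (ha.asymm _ _ _ _ huv)

end IsCornerTriple

/-- The third triangle is the target of the cyclic arc at the same corner of `u`, which exists by
counting. -/
theorem IsArcSystem.exists_cornerTriple {a : Color → V → V → Prop} (ha : IsArcSystem G R a)
    (hR : IsRTRepresentation G R) {k : Color} {u v : V} (h : a k u v)
    (hn : ¬ CyclicArc G R k u v) : ∃ w, IsCornerTriple R k u v w := by
  have hu := ha.inner k u v h
  have huv := ha.ne k u v h
  have hs := ha.mem_side k u v h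
  have hv : (R v).corner k.succ.succ = (R u).corner k := by
    by_contra hne
    exact hn ⟨hu, huv, hs, hne⟩
  obtain ⟨w, hw, -⟩ := (isArcSystem_cyclicArc hR).out u hu k
  have hvw : v ≠ w := by rintro rfl; exact hn hw
  refine ⟨w, huv, hw.2.1, hvw, hv, ?_⟩
  rcases (hR.separate hvw).corners_of_mem_side hs hw.2.2.1 with ⟨h1, h2⟩ | ⟨h1, h2⟩
  · exact absurd (corner_injective (hR.proper v) (hv.trans h1.symm)) (Color.succ_ne _)
  · exact h2

/-- A Schnyder wood that corresponds to `R` can be flipped so that fewer arcs differ from the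
cyclic arcs. -/
theorem exists_facialFlip (hR : IsRTRepresentation G R) {T : SchnyderWood G}
    (hT : Corresponds R T) {k : Color} {u v : V} (h : T.arc k u v)
    (hn : ¬ CyclicArc G R k u v) :
    ∃ T' : SchnyderWood G, Corresponds R T' ∧ FacialFlip T T' ∧
      (∀ m x y, T'.arc m x y → ¬ CyclicArc G R m x y → T.arc m x y) ∧ ¬ T'.arc k u v := by
  have ha := SchnyderWood.isArcSystem hT
  have hc := isArcSystem_cyclicArc hR
  obtain ⟨w, htr⟩ := ha.exists_cornerTriple hR h hn
  have hu := ha.inner k u v h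
  have hin : ∃ x, ¬ G.IsOuter x := ⟨u, hu⟩
  obtain ⟨r, b, g, hF⟩ := hR.exists_frame hin
  have hv : ¬ G.IsOuter v := fun ho => hF.corner_notMem_region hR ho hu k.succ.succ
    (htr.corner_v ▸ corner_mem_region (hR.proper u) k)
  have hw : ¬ G.IsOuter w := fun ho => hF.corner_notMem_region hR ho hu k.succ
    (htr.corner_w ▸ corner_mem_region (hR.proper u) k)
  have htr₁ := htr.rotate
  have htr₂ := htr₁.rotate
  have avw := htr.arc_vw hR ha hv h
  have awu := htr.arc_rotate hR ha hw h ⟨_, avw⟩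
  have cuw := htr.cyclicArc hR hu
  have cwv := htr₁.cyclicArc hR hw
  have cvu := htr₂.cyclicArc hR hv
  -- Within the triple, each vertex can only use its corner at the common point, in either system.
  -- Hence exchanging the arcs there preserves out-degrees and the colours at each tail.
  have hS : ∀ x ∈ ({u, v, w} : Set V), ∃ i, (∃ y ∈ ({u, v, w} : Set V), T.arc i x y) ∧
      (∃ y ∈ ({u, v, w} : Set V), CyclicArc G R i x y) ∧
      ∀ m, ∀ y ∈ ({u, v, w} : Set V), T.arc m x y ∨ CyclicArc G R m x y → m = i := by
    have hcol : ∀ {i x y z}, IsCornerTriple R i x y z → ∀ {m t}, t = x ∨ t = y ∨ t = z →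
        T.arc m x t ∨ CyclicArc G R m x t → m = i := by
      intro i x y z h m t ht hm
      have hside : x ≠ t ∧ (R x).corner m ∈ (R t).side m := by
        rcases hm with hm | hm
        · exact ⟨ha.ne _ _ _ hm, ha.mem_side _ _ _ hm⟩
        · exact ⟨hc.ne _ _ _ hm, hc.mem_side _ _ _ hm⟩
      exact h.arc_eq_color hR (ht.resolve_left hside.1.symm) hside.2
    rintro x (rfl | rfl | rfl)
    · exact ⟨k, ⟨v, by simp, h⟩, ⟨w, by simp, cuw⟩, fun m y hy => hcol htr hy⟩
    · refine ⟨k.succ.succ, ⟨w, by simp, avw⟩, ⟨u, by simp, cvu⟩, fun m y hy => hcol htr₂ ?_⟩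
      rcases hy with rfl | rfl | rfl <;> simp
    · refine ⟨k.succ, ⟨u, by simp, awu⟩, ⟨v, by simp, cwv⟩, fun m y hy => hcol htr₁ ?_⟩
      rcases hy with rfl | rfl | rfl <;> simp
  have hp := ha.piecewise hc _ hS
  refine ⟨hp.toSchnyderWood hR hin, hp.mem_side, ⟨u, v, w, k, k.succ.succ, k.succ,
    Or.inr (htr.isFace hR), ⟨h, avw, awu⟩, ⟨Or.inl ⟨by simp, cuw⟩, Or.inl ⟨by simp, cvu⟩,
    Or.inl ⟨by simp, cwv⟩⟩, fun m x y hxy => ⟨?_, fun ht => Or.inr ⟨hxy, ht⟩⟩⟩, ?_, ?_⟩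
  · rintro (⟨hs, -⟩ | ⟨-, ht⟩)
    · exact absurd hs hxy
    · exact ht
  · rintro m x y (⟨-, ht⟩ | ⟨-, ht⟩) hno
    · exact absurd ht hno
    · exact ht
  · rintro (⟨-, ht⟩ | ⟨hs, -⟩)
    · exact hn ht
    · exact hs (by simp)

/-- Induction on the number of arcs of `T` that are not cyclic. At zero, `T` is the cyclic wood
because both have exactly one arc per corner. -/
theorem flips_to_cyclicArc (hR : IsRTRepresentation G R) (hin : ∃ x, ¬ G.IsOuter x)
    {T : SchnyderWood G} (hT : Corresponds R T) :
    ObtainedByFacialFlips T ((isArcSystem_cyclicArc hR).toSchnyderWood hR hin) := by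
  induction hn : {p : Color × V × V | T.arc p.1 p.2.1 p.2.2 ∧
    ¬ CyclicArc G R p.1 p.2.1 p.2.2}.ncard using Nat.strong_induction_on generalizing T with
  | _ n ih
  by_cases hd : ∃ k u v, T.arc k u v ∧ ¬ CyclicArc G R k u v
  · obtain ⟨k, u, v, h, hno⟩ := hd
    obtain ⟨T', hT', hflip, hsub, hnot⟩ := exists_facialFlip hR hT h hno
    refine Relation.ReflTransGen.head hflip (ih _ ?_ hT' rfl)
    rw [← hn]
    refine Set.ncard_lt_ncard ⟨fun p hp => ⟨hsub _ _ _ hp.1 hp.2, hp.2⟩, fun hsup => ?_⟩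
      (Set.toFinite _)
    exact hnot (hsup (show (k, u, v) ∈ _ from ⟨h, hno⟩)).1
  · push Not at hd
    have hc := isArcSystem_cyclicArc hR
    have : T = hc.toSchnyderWood hR hin := by
      ext k u v
      refine ⟨hd k u v, fun h => ?_⟩
      have hu := hc.inner k u v h
      obtain ⟨y, hy, -⟩ := T.out_inner u hu k
      rwa [(hc.out u hu k).unique h (hd k u y hy)]
    rw [this]
    exact Relation.ReflTransGen.refl

/-! ### Conclusions for a single representation. -/

theorem exists_corresponds (hR : IsRTRepresentation G R) :
    ∃ T : SchnyderWood G, Corresponds R T := by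
  by_cases hin : ∃ x, ¬ G.IsOuter x
  · exact ⟨(isArcSystem_cyclicArc hR).toSchnyderWood hR hin, (isArcSystem_cyclicArc hR).mem_side⟩
  -- With outer vertices only there are no inner edges, and the wood without arcs serves.
  · push Not at hin
    exact ⟨{
      arc := fun _ _ _ => False
      arc_inner := fun _ _ _ h => h.elim
      arc_exists := fun u v h => absurd ⟨hin u, hin v⟩ h.2
      arc_asymm := fun _ _ _ _ h => h.elim
      arc_color := fun _ _ _ _ h => h.elim
      out_inner := fun v hv => absurd (hin v) hv
      out_outer := fun _ _ _ _ h => h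
      after_out := fun _ _ _ _ h => h.elim
      after_in := fun _ _ _ _ h => h.elim
      outer_color := ⟨fun k => match k with
        | .red => G.outer₁ | .green => G.outer₂ | .blue => G.outer₃,
        Or.inl ⟨rfl, rfl, rfl⟩, fun _ _ _ h => h.elim⟩ }, fun _ _ _ h => h.elim⟩

theorem obtainedByFacialFlips_of_corresponds (hR : IsRTRepresentation G R)
    {T T' : SchnyderWood G} (hT : Corresponds R T) (hT' : Corresponds R T') :
    ObtainedByFacialFlips T T' := by
  by_cases hin : ∃ x, ¬ G.IsOuter x
  · exact (flips_to_cyclicArc hR hin hT).trans (flips_to_cyclicArc hR hin hT').symm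
  · push Not at hin
    have : T = T' := by
      ext k u v
      exact ⟨fun h => absurd h (T.out_outer u (hin u) k v),
        fun h => absurd h (T'.out_outer u (hin u) k v)⟩
    rw [this]
    exact Relation.ReflTransGen.refl

theorem exists_isTopmost_iff (hR : IsRTRepresentation G R) (hcard : 3 < Fintype.card V) :
    ∃ v, ∀ u, IsTopmost R u ↔ u = v := by
  have hin : ∃ x, ¬ G.IsOuter x := by
    by_contra! hc
    have h1 := G.ncard_isOuter
    rw [Set.eq_univ_of_forall (s := {v | G.IsOuter v}) hc, Set.ncard_univ,
      Nat.card_eq_fintype_card] at h1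
    omega
  obtain ⟨r, b, g, hF⟩ := hR.exists_frame hin
  exact ⟨r, hF.isTopmost_iff hR⟩

/-! ### Morphs -/

/-- If finitely many closed conditions cover a segment, and conditions that hold at the same time
are related, then conditions that hold at the two ends are related. -/
theorem rel_of_closed_cover {α : Type*} [Finite α] {P : α → ℝ → Prop} {r : α → α → Prop}
    (hr : ∀ a b c, r a b → r b c → r a c) (hclosed : ∀ a, IsClosed {s | P a s})
    (hcover : ∀ s ∈ Set.Icc (0 : ℝ) 1, ∃ a, P a s)
    (hrel : ∀ s ∈ Set.Icc (0 : ℝ) 1, ∀ a b, P a s → P b s → r a b) {a b : α} (ha : P a 0)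
    (hb : P b 1) : r a b := by
  by_contra hab
  have h0 : (0 : ℝ) ∈ Set.Icc (0 : ℝ) 1 := by simp
  have h1 : (1 : ℝ) ∈ Set.Icc (0 : ℝ) 1 := by simp
  have hU : IsClosed (⋃ c ∈ {c | r a c}, {s | P c s}) :=
    (Set.toFinite _).isClosed_biUnion fun c _ => hclosed c
  have hU' : IsClosed (⋃ c ∈ {c | ¬ r a c}, {s | P c s}) :=
    (Set.toFinite _).isClosed_biUnion fun c _ => hclosed c
  obtain ⟨s, hs, hs1, hs2⟩ := isPreconnected_closed_iff.1 (isPreconnected_Icc (a := (0 : ℝ))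
    (b := 1)) _ _ hU hU' (fun s hs => by
      obtain ⟨c, hc⟩ := hcover s hs
      by_cases h : r a c
      · exact Or.inl (Set.mem_biUnion (x := c) h hc)
      · exact Or.inr (Set.mem_biUnion (x := c) h hc))
    ⟨0, h0, Set.mem_biUnion (x := a) (hrel 0 h0 a a ha ha) ha⟩
    ⟨1, h1, Set.mem_biUnion (x := b) hab hb⟩
  obtain ⟨c, hc, hcs⟩ := Set.mem_iUnion₂.1 hs1
  obtain ⟨d, hd, hds⟩ := Set.mem_iUnion₂.1 hs2
  exact hd (hr _ _ _ hc (hrel s hs c d hcs hds))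

namespace RightTriangle

/-- The equations and inequalities that describe the side of colour `k` of a proper triangle. -/
def SideEquations (A : RightTriangle) (q : ℝ × ℝ) : Color → Prop
  | .red => q.2 = A.bottom ∧ A.left ≤ q.1 ∧ q.1 ≤ A.right
  | .blue => q.1 = A.right ∧ A.bottom ≤ q.2 ∧ q.2 ≤ A.top
  | .green => A.slack q = 0 ∧ A.left ≤ q.1 ∧ q.1 ≤ A.right

theorem mem_side_iff {A : RightTriangle} (hA : A.Proper) {q : ℝ × ℝ} {k : Color} :
    q ∈ A.side k ↔ A.SideEquations q k := by
  cases k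
  · exact mem_side_red hA
  · exact mem_side_blue hA
  · exact mem_side_green hA

/-- The conditions are weak inequalities and equations between polynomials in the time. Unlike
membership in a segment, they are visibly closed, and they agree with it for proper triangles. -/
theorem isClosed_sideEquations_lerp (A A' B B' : RightTriangle) (k : Color) :
    IsClosed {s | (lerp s A A').SideEquations ((lerp s B B').corner k) k} := by
  cases k <;> simp only [SideEquations, corner, slack, lerp, Set.ofPred_and] <;>
    refine (isClosed_eq ?_ ?_).inter ((isClosed_le ?_ ?_).inter (isClosed_le ?_ ?_)) <;> fun_prop

theorem lerp_zero (A B : RightTriangle) : lerp 0 A B = A := by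
  simp [lerp]

theorem lerp_one (A B : RightTriangle) : lerp 1 A B = B := by
  simp [lerp]

end RightTriangle

instance : Finite (SchnyderWood G) :=
  Finite.of_injective SchnyderWood.arc fun _ _ h => SchnyderWood.ext h

/-- The finitely many Schnyder woods index the closed cover; woods that correspond at the same time
are related by flips. -/
theorem LinearMorph.obtainedByFacialFlips {R' : V → RightTriangle} (h : LinearMorph G R R')
    {T T' : SchnyderWood G} (hT : Corresponds R T) (hT' : Corresponds R' T') :
    ObtainedByFacialFlips T T' := by
  have hiff : ∀ s ∈ Set.Icc (0 : ℝ) 1, ∀ T : SchnyderWood G,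
      (∀ k u v, T.arc k u v →
        (lerp s (R v) (R' v)).SideEquations ((lerp s (R u) (R' u)).corner k) k) ↔
      Corresponds (fun v => lerp s (R v) (R' v)) T := fun s hs T =>
    forall₄_congr fun k u v _ => (mem_side_iff ((h s hs).proper v)).symm
  refine rel_of_closed_cover (r := ObtainedByFacialFlips)
    (P := fun (T : SchnyderWood G) s => ∀ k u v, T.arc k u v →
      (lerp s (R v) (R' v)).SideEquations ((lerp s (R u) (R' u)).corner k) k)
    (fun _ _ _ => Relation.ReflTransGen.trans) (fun T => ?_) (fun s hs => ?_)
    (fun s hs T₁ T₂ h₁ h₂ => ?_) ?_ ?_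
  · simp only [Set.ofPred_forall]
    exact isClosed_iInter fun k => isClosed_iInter fun u => isClosed_iInter fun v =>
      isClosed_iInter fun _ => isClosed_sideEquations_lerp _ _ _ _ k
  · obtain ⟨T, hT⟩ := exists_corresponds (h s hs)
    exact ⟨T, (hiff s hs T).2 hT⟩
  · exact obtainedByFacialFlips_of_corresponds (h s hs) ((hiff s hs T₁).1 h₁)
      ((hiff s hs T₂).1 h₂)
  · rw [hiff 0 (by simp)]; simpa only [lerp_zero] using hT
  · rw [hiff 1 (by simp)]; simpa only [lerp_one] using hT'

theorem LinearMorph.eq_of_isTopmost {R' : V → RightTriangle} (h : LinearMorph G R R')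
    (hcard : 3 < Fintype.card V) {v v' : V} (hv : IsTopmost R v) (hv' : IsTopmost R' v') :
    v = v' := by
  refine rel_of_closed_cover (r := Eq)
    (P := fun v s => IsTopmost (fun v => lerp s (R v) (R' v)) v) (fun _ _ _ => Eq.trans)
    (fun v => ?_) (fun s hs => ?_) (fun s hs v₁ v₂ h₁ h₂ => ?_) ?_ ?_
  · simp only [IsTopmost, Set.ofPred_forall, lerp]
    exact isClosed_iInter fun u => isClosed_le (by fun_prop) (by fun_prop)
  · obtain ⟨v, hv⟩ := exists_isTopmost_iff (h s hs) hcard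
    exact ⟨v, (hv v).2 rfl⟩
  · obtain ⟨v, hv⟩ := exists_isTopmost_iff (h s hs) hcard
    exact ((hv v₁).1 h₁).trans ((hv v₂).1 h₂).symm
  · simpa only [lerp_zero] using hv
  · simpa only [lerp_one] using hv'

theorem LinearMorph.isRTRepresentation_left {R' : V → RightTriangle} (h : LinearMorph G R R') :
    IsRTRepresentation G R := by
  simpa only [lerp_zero] using h 0 (by simp)

theorem PiecewiseLinearMorph.reflTransGen {R' : V → RightTriangle}
    (h : PiecewiseLinearMorph G R R') : Relation.ReflTransGen (LinearMorph G) R R' := by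
  obtain ⟨m, S, rfl, rfl, hS⟩ := h
  induction m with
  | zero => exact Relation.ReflTransGen.refl
  | succ m ih => exact (ih fun i hi => hS i (by omega)).tail (hS m (by omega))

theorem PiecewiseLinearMorph.obtainedByFacialFlips {R' : V → RightTriangle}
    (hR : IsRTRepresentation G R) (h : PiecewiseLinearMorph G R R') {T T' : SchnyderWood G}
    (hT : Corresponds R T) (hT' : Corresponds R' T') : ObtainedByFacialFlips T T' := by
  replace h := h.reflTransGen
  induction h generalizing T' with
  -- Even for the trivial morph, `T` and `T'` may be different woods of one degenerate
  -- representation.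
  | refl => exact obtainedByFacialFlips_of_corresponds hR hT hT'
  | tail _ hlin ih =>
    obtain ⟨T₁, hT₁⟩ := exists_corresponds hlin.isRTRepresentation_left
    exact (ih hT₁).trans (hlin.obtainedByFacialFlips hT₁ hT')

theorem PiecewiseLinearMorph.eq_of_isTopmost {R' : V → RightTriangle}
    (hR : IsRTRepresentation G R) (h : PiecewiseLinearMorph G R R') (hcard : 3 < Fintype.card V)
    {v v' : V} (hv : IsTopmost R v) (hv' : IsTopmost R' v') : v = v' := by
  replace h := h.reflTransGen
  induction h generalizing v' with
  | refl =>
    obtain ⟨w, hw⟩ := exists_isTopmost_iff hR hcard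
    exact ((hw v).1 hv).trans ((hw v').1 hv').symm
  | tail _ hlin ih =>
    obtain ⟨w, hw⟩ := exists_isTopmost_iff hlin.isRTRepresentation_left hcard
    exact (ih ((hw w).2 rfl)).trans (hlin.eq_of_isTopmost hcard ((hw w).2 rfl) hv')

end RTMorph

theorem theorem1 {V : Type*} [Fintype V] (G : RTMorph.PlaneTriangulation V)
    (R R' : V → RTMorph.RightTriangle)
    (hR : RTMorph.IsRTRepresentation G R) (hR' : RTMorph.IsRTRepresentation G R')
    (hmorph : RTMorph.PiecewiseLinearMorph G R R') :
    (∃ T : RTMorph.SchnyderWood G, RTMorph.Corresponds R T) ∧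
    (∃ T' : RTMorph.SchnyderWood G, RTMorph.Corresponds R' T') ∧
    (∀ T T' : RTMorph.SchnyderWood G, RTMorph.Corresponds R T → RTMorph.Corresponds R' T' →
      RTMorph.ObtainedByFacialFlips T T' ∧ RTMorph.ObtainedByFacialFlips T' T) ∧
    (3 < Fintype.card V →
      ∃ v : V, (∀ u, RTMorph.IsTopmost R u ↔ u = v) ∧ (∀ u, RTMorph.IsTopmost R' u ↔ u = v)) := by
  refine ⟨RTMorph.exists_corresponds hR, RTMorph.exists_corresponds hR', fun T T' hT hT' => ?_,
    fun hcard => ?_⟩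
  · have h := hmorph.obtainedByFacialFlips hR hT hT'
    exact ⟨h, h.symm⟩
  · obtain ⟨v, hv⟩ := RTMorph.exists_isTopmost_iff hR hcard
    obtain ⟨v', hv'⟩ := RTMorph.exists_isTopmost_iff hR' hcard
    have h := hmorph.eq_of_isTopmost hR hcard ((hv v).2 rfl) ((hv' v').2 rfl)
    exact ⟨v, hv, h ▸ hv'⟩
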